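/- For $m\ge 1$ let $T(2,0,\dots,0)$ denote the space of smooth symmetric $2$-forms on a $2m$-dimensional symplectic manifold $M$, i.e. of smooth tensor fields whose fibre is the irreducible $Sp(2m;\mathbb R)$-module of symmetric bilinear forms on $\mathbb R^{2m}$ (highest weight $(2,0,\dots,0)$). A symplectic manifold is considered through its canonical coordinate systems $(x_1,\dots,x_m,y_1,\dots,y_m)$, in which $\omega=\sum_i dx_i\wedge dy_i$. A bilinear operator is called invariant under symplectomorphisms if it is given by one and the same bilinear differential expression in all canonical coordinate systems of all $2m$-dimensional symplectic manifolds; its order is the total order of differentiation with respect to both arguments. For every $m\ge 1$ there exists a bilinear differential operator $$Gz: T(2,0,\dots,0)\times T(2,0,\dots,0)\longrightarrow T(2,0,\dots,0),$$ defined on every $2m$-dimensional symplectic manifold, of order exactly $2$ (that is, of order at most $2$ and not of order at most $1$) and invariant under symplectomorphisms; in particular it commutes with every symplectomorphism $M\to N$. Thus $Gz$ defines an algebra structure on the space of symmetric $2$-forms (metrics). For $m=1$, in canonical coordinates $x,y$ with $\omega=dx\wedge dy$ and $\{f,g\}=\frac{\partial f}{\partial x}\frac{\partial g}{\partial y}-\frac{\partial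 f}{\partial y}\frac{\partial g}{\partial x}$, the operator sends the pair $a\,dx^2+2b\,dxdy+c\,dy^2$, $a'dx^2+2b'dxdy+c'dy^2$ to $$\frac{\partial^2 g}{\partial x^2}dx^2+2\frac{\partial^2 g}{\partial x\partial y}dxdy+\frac{\partial^2 g}{\partial y^2}dy^2$$ $$+\Big(\frac{\partial^2 a}{\partial y^2}-2\frac{\partial^2 b}{\partial x\partial y}+\frac{\partial^2 c}{\partial x^2}\Big)(a'dx^2+2b'dxdy+c'dy^2)$$ $$+\Big(\frac{\partial^2 a'}{\partial y^2}-2\frac{\partial^2 b'}{\partial x\partial y}+\frac{\partial^2 c'}{\partial x^2}\Big)(a\,dx^2+2b\,dxdy+c\,dy^2)$$ $$+(\{a,b'\}-\{b,a'\})dx^2+(\{a,c'\}-\{c,a'\})dxdy+(\{b,c'\}-\{c,b'\})dy^2,$$ where $g=ac'-2bb'+ca'$. -/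

import Mathlib

open Set Topology Manifold
open scoped ContDiff Matrix

set_option maxSynthPendingDepth 3

universe u

noncomputable section

/-- The coordinate space `ℝ²ᵐ`.  The coordinate indexed by `Sum.inl i` is `xᵢ`, the one indexed by
`Sum.inr i` is `yᵢ`, and the canonical symplectic form is `ω = ∑ᵢ dxᵢ ∧ dyᵢ`. -/
abbrev Coord (m : ℕ) : Type := Fin m ⊕ Fin m → ℝ

/-- The real symplectic group `Sp(2m; ℝ)`. -/
abbrev Sp (m : ℕ) : Submonoid (Matrix (Fin m ⊕ Fin m) (Fin m ⊕ Fin m) ℝ) :=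
  Matrix.symplecticGroup (Fin m) ℝ

/-- The linear map of `ℝ²ᵐ` given by a symplectic matrix. -/
def Sp.toCLM {m : ℕ} (g : Sp m) : Coord m →L[ℝ] Coord m :=
  LinearMap.toContinuousLinearMap (Matrix.mulVecLin (g : Matrix _ _ ℝ))

@[simp] theorem Sp.toCLM_apply {m : ℕ} (g : Sp m) (v : Coord m) :
    Sp.toCLM g v = (g : Matrix _ _ ℝ) *ᵥ v := rfl

theorem Sp.toCLM_one (m : ℕ) : Sp.toCLM (1 : Sp m) = ContinuousLinearMap.id ℝ (Coord m) := by
  ext1 v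
  simp

theorem Sp.toCLM_mul {m : ℕ} (g h : Sp m) :
    Sp.toCLM (g * h) = (Sp.toCLM g).comp (Sp.toCLM h) := by
  ext1 v
  simp

/-- Smooth maps between open subsets of `ℝ²ᵐ` that preserve `ω`: the Jacobi matrix is symplectic at
every point. -/
def symplecticPregroupoid (m : ℕ) : Pregroupoid (Coord m) where
  property f U := ContDiffOn ℝ ∞ f U ∧ ∀ u ∈ U, ∃ g : Sp m, HasFDerivAt f (Sp.toCLM g) u
  comp := by
    rintro f g U V ⟨hf, hf'⟩ ⟨hg, hg'⟩ _ _ _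
    refine ⟨hg.comp (hf.mono inter_subset_left) (fun u hu => hu.2), ?_⟩
    rintro u ⟨hu, hv⟩
    obtain ⟨a, ha⟩ := hf' u hu
    obtain ⟨b, hb⟩ := hg' _ hv
    refine ⟨b * a, ?_⟩
    rw [Sp.toCLM_mul]
    exact hb.comp u ha
  id_mem := ⟨contDiffOn_id, fun u _ => ⟨1, by rw [Sp.toCLM_one]; exact hasFDerivAt_id u⟩⟩
  locality := by
    intro f U _ h
    refine ⟨fun u hu => ?_, fun u hu => ?_⟩
    · obtain ⟨v, hv, huv, hfv, _⟩ := h u hu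
      exact (contDiffWithinAt_inter (hv.mem_nhds huv)).1 (hfv u ⟨hu, huv⟩)
    · obtain ⟨v, _, huv, _, hfv⟩ := h u hu
      exact hfv u ⟨hu, huv⟩
  congr := by
    rintro f g U hU hfg ⟨hf, hf'⟩
    refine ⟨hf.congr hfg, fun u hu => ?_⟩
    obtain ⟨a, ha⟩ := hf' u hu
    exact ⟨a, ha.congr_of_eventuallyEq (Filter.eventuallyEq_of_mem (hU.mem_nhds hu) hfg)⟩

/-- The pseudogroup of local symplectomorphisms of `(ℝ²ᵐ, ω)`. -/
def symplecticGroupoid (m : ℕ) : StructureGroupoid (Coord m) :=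
  (symplecticPregroupoid m).groupoid

/-- A symplectic manifold of dimension `2m`, given by its canonical (Darboux) coordinate systems:
a space with an atlas modelled on `ℝ²ᵐ` whose transition maps preserve `ω`. -/
abbrev IsSymplecticManifold (m : ℕ) (M : Type*) [TopologicalSpace M] [ChartedSpace (Coord m) M] :
    Prop :=
  HasGroupoid M (symplecticGroupoid m)

/-- All canonical coordinate systems on the symplectic manifold `M`. -/
abbrev DarbouxChart (m : ℕ) (M : Type*) [TopologicalSpace M] [ChartedSpace (Coord m) M] : Type _ :=
  (symplecticGroupoid m).maximalAtlas M

section TensorFields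

variable {m : ℕ} {V : Type*} [NormedAddCommGroup V] [NormedSpace ℝ V]

/-- `T(ρ)`: the space of smooth tensor fields of type `ρ` on `M`.  Such a field `t` has a smooth
expression `t e` with values in `V` in every canonical coordinate system `e`, and passing from the
coordinates `x` to the coordinates `y` is governed by `t(y(x)) = ρ(∂y/∂x) t(x)`.  The expression
in `e` matters on `e.target` only, and is taken to be `0` elsewhere. -/
def TensorField (ρ : Representation ℝ (Sp m) V) (M : Type*) [TopologicalSpace M]
    [ChartedSpace (Coord m) M] : Submodule ℝ (DarbouxChart m M → Coord m → V) where
  carrier := {t |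
    (∀ e, ContDiffOn ℝ ∞ (t e) e.1.target) ∧
    (∀ e, ∀ u ∉ e.1.target, t e u = 0) ∧
    ∀ (e e' : DarbouxChart m M), ∀ u ∈ (e.1.symm ≫ₕ e'.1).source, ∀ g : Sp m,
      HasFDerivAt (e.1.symm ≫ₕ e'.1) (Sp.toCLM g) u →
        t e' ((e.1.symm ≫ₕ e'.1) u) = ρ g (t e u)}
  zero_mem' := ⟨fun _ => contDiffOn_const, fun _ _ _ => rfl, fun _ _ _ _ _ _ => by simp⟩
  add_mem' := by
    rintro s t ⟨hs, hs0, hs'⟩ ⟨ht, ht0, ht'⟩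
    refine ⟨fun e => (hs e).add (ht e), fun e u hu => ?_, fun e e' u hu g hg => ?_⟩
    · simp [hs0 e u hu, ht0 e u hu]
    · have h1 := hs' e e' u hu g hg
      have h2 := ht' e e' u hu g hg
      simp only [Pi.add_apply, map_add, h1, h2]
  smul_mem' := by
    rintro r t ⟨ht, ht0, ht'⟩
    refine ⟨fun e => contDiffOn_const.smul (ht e), fun e u hu => ?_, fun e e' u hu g hg => ?_⟩
    · simp [ht0 e u hu]
    · have h := ht' e e' u hu g hg
      simp only [Pi.smul_apply, map_smul, h]

/-- The expression of a tensor field in a canonical coordinate system. -/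
def inChart {ρ : Representation ℝ (Sp m) V} {M : Type*} [TopologicalSpace M]
    [ChartedSpace (Coord m) M] (t : TensorField ρ M) (e : DarbouxChart m M) : Coord m → V :=
  t.1 e

/-- The symplectomorphism `f : M → N` carries the tensor field `s` on `M` to the tensor field `t`
on `N`. -/
def Carries {ρ : Representation ℝ (Sp m) V} {M N : Type*} [TopologicalSpace M]
    [ChartedSpace (Coord m) M] [TopologicalSpace N] [ChartedSpace (Coord m) N]
    (f : Structomorph (symplecticGroupoid m) M N) (s : TensorField ρ M) (t : TensorField ρ N) :
    Prop :=
  ∀ (e : DarbouxChart m M) (e' : DarbouxChart m N),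
    ∀ u ∈ (e.1.symm ≫ₕ f.toHomeomorph.toOpenPartialHomeomorph ≫ₕ e'.1).source, ∀ g : Sp m,
      HasFDerivAt (e.1.symm ≫ₕ f.toHomeomorph.toOpenPartialHomeomorph ≫ₕ e'.1) (Sp.toCLM g) u →
        inChart t e' ((e.1.symm ≫ₕ f.toHomeomorph.toOpenPartialHomeomorph ≫ₕ e'.1) u) =
          ρ g (inChart s e u)

end TensorFields

section Operators

variable {m : ℕ} {V₁ V₂ W : Type*} [NormedAddCommGroup V₁] [NormedSpace ℝ V₁]
  [NormedAddCommGroup V₂] [NormedSpace ℝ V₂] [NormedAddCommGroup W] [NormedSpace ℝ W]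

/-- `D` is a bilinear differential operator of order at most `k` (the total order with respect to
both arguments) with smooth coefficients, acting on germs of smooth vector functions on `ℝ²ᵐ`. -/
def IsBilinearDiffOp (k : ℕ) (D : (Coord m → V₁) → (Coord m → V₂) → Coord m → W) : Prop :=
  ∃ c : (i j : ℕ) → Coord m →
      ((Coord m [×i]→L[ℝ] V₁) →L[ℝ] (Coord m [×j]→L[ℝ] V₂) →L[ℝ] W),
    (∀ i j, ContDiff ℝ ∞ (c i j)) ∧
    ∀ s t u, ContDiffAt ℝ ∞ s u → ContDiffAt ℝ ∞ t u →
      D s t u = ∑ n ∈ Finset.range (k + 1), ∑ p ∈ Finset.HasAntidiagonal.antidiagonal n,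
        c p.1 p.2 u (iteratedFDeriv ℝ p.1 s u) (iteratedFDeriv ℝ p.2 t u)

/-- A bilinear operator `T(ρ₁) × T(ρ₂) → T(τ)` on every symplectic manifold of dimension `2m`. -/
abbrev BilinearOperator (ρ₁ : Representation ℝ (Sp m) V₁) (ρ₂ : Representation ℝ (Sp m) V₂)
    (τ : Representation ℝ (Sp m) W) : Type _ :=
  (M : Type u) → [TopologicalSpace M] → [ChartedSpace (Coord m) M] → [IsSymplecticManifold m M] →
    (TensorField ρ₁ M →ₗ[ℝ] TensorField ρ₂ M →ₗ[ℝ] TensorField τ M)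

/-- The operator `B` has one and the same expression `D` in all canonical coordinate systems. -/
def IsExpressedBy {ρ₁ : Representation ℝ (Sp m) V₁} {ρ₂ : Representation ℝ (Sp m) V₂}
    {τ : Representation ℝ (Sp m) W} (B : BilinearOperator ρ₁ ρ₂ τ)
    (D : (Coord m → V₁) → (Coord m → V₂) → Coord m → W) : Prop :=
  ∀ (M : Type u) [TopologicalSpace M] [ChartedSpace (Coord m) M] [IsSymplecticManifold m M]
    (s : TensorField ρ₁ M) (t : TensorField ρ₂ M) (e : DarbouxChart m M), ∀ u ∈ e.1.target,
      inChart (B M s t) e u = D (inChart s e) (inChart t e) u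

/-- The operator `B` commutes with symplectomorphisms. -/
def CommutesWithSymplectomorphisms {ρ₁ : Representation ℝ (Sp m) V₁}
    {ρ₂ : Representation ℝ (Sp m) V₂} {τ : Representation ℝ (Sp m) W}
    (B : BilinearOperator ρ₁ ρ₂ τ) : Prop :=
  ∀ (M N : Type u) [TopologicalSpace M] [ChartedSpace (Coord m) M] [IsSymplecticManifold m M]
    [TopologicalSpace N] [ChartedSpace (Coord m) N] [IsSymplecticManifold m N]
    (f : Structomorph (symplecticGroupoid m) M N)
    (s : TensorField ρ₁ M) (s' : TensorField ρ₁ N) (t : TensorField ρ₂ M) (t' : TensorField ρ₂ N),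
      Carries f s s' → Carries f t t' → Carries f (B M s t) (B N s' t')

end Operators

/-- The space of symmetric bilinear forms on `ℝ²ᵐ`. -/
def SymForm (m : ℕ) : Submodule ℝ (Coord m →L[ℝ] Coord m →L[ℝ] ℝ) where
  carrier := {b | ∀ v w, b v w = b w v}
  zero_mem' := fun _ _ => rfl
  add_mem' := by
    intro a b ha hb v w
    simp [ha v w, hb v w]
  smul_mem' := by
    intro r b hb v w
    simp [hb v w]

/-- The representation of `Sp(2m; ℝ)` on symmetric bilinear forms, `(g b)(v, w) = b(g⁻¹v, g⁻¹w)`.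
It is the irreducible representation with highest weight `(2, 0, …, 0)`. -/
def symFormRep (m : ℕ) : Representation ℝ (Sp m) (SymForm m) where
  toFun g :=
    { toFun := fun b =>
        ⟨b.1.bilinearComp (Sp.toCLM g⁻¹) (Sp.toCLM g⁻¹), fun v w => b.2 _ _⟩
      map_add' := fun _ _ => rfl
      map_smul' := fun _ _ => rfl }
  map_one' := by
    ext b : 1
    apply Subtype.ext
    ext1 v
    ext1 w
    simp
  map_mul' g h := by
    ext b : 1
    apply Subtype.ext
    ext1 v
    ext1 w
    change b.1 _ _ = b.1 _ _
    simp

/-- `T(2, 0, …, 0)`: the space of smooth symmetric 2-forms on `M`. -/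
abbrev SymTwoForms (m : ℕ) (M : Type*) [TopologicalSpace M] [ChartedSpace (Coord m) M] :
    Submodule ℝ (DarbouxChart m M → Coord m → SymForm m) :=
  TensorField (symFormRep m) M

/-- The value `b(v, w)` of a symmetric form. -/
def formValue {m : ℕ} (b : SymForm m) (v w : Coord m) : ℝ := b.1 v w

/-- The derivative with respect to the coordinate `i`. -/
def partialDeriv {m : ℕ} (i : Fin m ⊕ Fin m) (f : Coord m → ℝ) : Coord m → ℝ :=
  fun u => fderiv ℝ f u (Pi.single i 1)

/-- The Poisson bracket `{f, g} = ∑ᵢ (∂f/∂xᵢ ∂g/∂yᵢ - ∂f/∂yᵢ ∂g/∂xᵢ)`. -/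
def poisson {m : ℕ} (f g : Coord m → ℝ) : Coord m → ℝ := fun u =>
  ∑ i : Fin m,
    (partialDeriv (Sum.inl i) f u * partialDeriv (Sum.inr i) g u -
      partialDeriv (Sum.inr i) f u * partialDeriv (Sum.inl i) g u)

/-- The first coordinate direction in the plane. -/
def ix : Fin 1 ⊕ Fin 1 := Sum.inl 0

/-- The second coordinate direction in the plane. -/
def iy : Fin 1 ⊕ Fin 1 := Sum.inr 0

/-- The function `∂²a/∂y² - 2 ∂²b/∂x∂y + ∂²c/∂x²`. -/
def secondDiv (a b c : Coord 1 → ℝ) : Coord 1 → ℝ := fun u =>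
  partialDeriv iy (partialDeriv iy a) u - 2 * partialDeriv ix (partialDeriv iy b) u +
    partialDeriv ix (partialDeriv ix c) u

/-- The value at the point `u` and the tangent vector `v = (dx, dy)` of the quadratic form that the
plane operator assigns to `a dx² + 2b dxdy + c dy²` and `a' dx² + 2b' dxdy + c' dy²`. -/
def planeGz (a b c a' b' c' : Coord 1 → ℝ) (u v : Coord 1) : ℝ :=
  let g : Coord 1 → ℝ := fun z => a z * c' z - 2 * (b z * b' z) + c z * a' z
  let dx : ℝ := v ix
  let dy : ℝ := v iy
  partialDeriv ix (partialDeriv ix g) u * dx ^ 2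
    + 2 * partialDeriv ix (partialDeriv iy g) u * (dx * dy)
    + partialDeriv iy (partialDeriv iy g) u * dy ^ 2
    + secondDiv a b c u * (a' u * dx ^ 2 + 2 * b' u * (dx * dy) + c' u * dy ^ 2)
    + secondDiv a' b' c' u * (a u * dx ^ 2 + 2 * b u * (dx * dy) + c u * dy ^ 2)
    + (poisson a b' u - poisson b a' u) * dx ^ 2
    + (poisson a c' u - poisson c a' u) * (dx * dy)
    + (poisson b c' u - poisson c b' u) * dy ^ 2

/-- The coefficient `h(∂ᵢ, ∂ⱼ)` of a symmetric 2-form in a canonical coordinate system. -/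
def coeff {m : ℕ} {M : Type*} [TopologicalSpace M] [ChartedSpace (Coord m) M]
    (h : SymTwoForms m M) (e : DarbouxChart m M) (i j : Fin m ⊕ Fin m) : Coord m → ℝ :=
  fun u => formValue (inChart h e u) (Pi.single i 1) (Pi.single j 1)

end

/-!
# An invariant product of symmetric 2-forms on symplectic manifolds

In canonical coordinates the product is an explicit contraction `gzExpr` of the 2-jets of the two
fields with two copies of the Poisson bivector `∑ₖ ∂ₖ ⊗ sharp k`; it has constant coefficients.
What has to be understood is why such an expression survives a nonlinear symplectic change of
coordinates `φ`, although the second derivatives of `φ^* s` involve the derivatives of `φ` up to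
order three.

The point is its value on squares of exact 1-forms (`gzExpr_sqDiff`):
`(dg)² ⋆ (dp)² = 2 ((d{g, p})² + d{g, {g, p}} dp + d{p, {p, g}} dg)`.
The right-hand side is written in terms of `d` and the Poisson bracket alone, so it commutes with
symplectic maps.  It remains to observe that every smooth field of symmetric forms is locally a
linear combination of squares `(dg)²`: it is a combination of the fields `f dg dh`, one has
`2 f dg dh = d(fg) dh + d(fh) dg - d(gh) df`, and `4 dg dh = (d(g + h))² - (d(g - h))²`.  This is
`SymForm.field_induction`, and by bilinearity it turns the special case into full invariance under
symplectic maps (`gzExpr_pullField`).  No transformation rule for second derivatives is needed.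

The identity on squares is a computation with contractions: both sides are polynomials in the
first three derivatives of `g` and `p`, contracted with the bivector (`contraction_two` and
`contraction_one`).

Given invariance, the local expressions glue to tensor fields on symplectic manifolds
(`gzOperator`).  The order is exactly two, because `x₁² dx₁²` has vanishing 1-jet at the origin and
still has a nonzero product with `dy₁²` there.  For `m = 1` the contractions are expanded in
coordinates (`gzExpr_plane`).
-/

noncomputable section

-- Instance search does not find its way through iterated spaces of continuous linear maps with
-- values in the subspace `SymForm m` without these shortcuts.
local instance (m : ℕ) : NormedAddCommGroup (SymForm m) := inferInstance
local instance (m : ℕ) : NormedSpace ℝ (SymForm m) := inferInstance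
local instance (m : ℕ) : NormedAddCommGroup (Coord m →L[ℝ] SymForm m) := inferInstance
local instance (m : ℕ) : NormedSpace ℝ (Coord m →L[ℝ] SymForm m) := inferInstance
local instance (m : ℕ) : NormedAddCommGroup (Coord m →L[ℝ] Coord m →L[ℝ] SymForm m) := inferInstance
local instance (m : ℕ) : NormedSpace ℝ (Coord m →L[ℝ] Coord m →L[ℝ] SymForm m) := inferInstance

/-! ### Symmetric forms -/

namespace SymForm

variable {m : ℕ}

/-- The evaluation `b ↦ b(v, w)`, as a continuous linear functional. -/
def eval (v w : Coord m) : SymForm m →L[ℝ] ℝ :=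
  ((ContinuousLinearMap.apply ℝ ℝ w).comp (ContinuousLinearMap.apply ℝ (Coord m →L[ℝ] ℝ) v)).comp
    (SymForm m).subtypeL

@[simp] theorem eval_apply (v w : Coord m) (b : SymForm m) : eval v w b = b.1 v w := rfl

/-- A symmetric form is determined by its quadratic form. -/
theorem ext_self {b c : SymForm m} (h : ∀ v, b.1 v v = c.1 v v) : b = c := by
  apply Subtype.ext
  ext1 v
  ext1 w
  have h1 := h (v + w)
  have h2 := h v
  have h3 := h w
  simp only [map_add, add_apply] at h1
  linarith [b.2 v w, c.2 v w]

/-- The symmetric product `½ (α ⊗ β + β ⊗ α)` of two linear functionals. -/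
def prod (α β : Coord m →L[ℝ] ℝ) : SymForm m :=
  ⟨(1 / 2 : ℝ) • (α.smulRight β + β.smulRight α), fun v w => by simp; ring⟩

theorem prod_apply (α β : Coord m →L[ℝ] ℝ) (v w : Coord m) :
    (prod α β).1 v w = 1 / 2 * (α v * β w + β v * α w) := by simp [prod]; ring

@[simp] theorem prod_apply_self (α β : Coord m →L[ℝ] ℝ) (v : Coord m) :
    (prod α β).1 v v = α v * β v := by
  rw [prod_apply]
  ring

theorem sum_apply {ι : Type*} (s : Finset ι) (f : ι → SymForm m) (v w : Coord m) :
    (∑ i ∈ s, f i).1 v w = ∑ i ∈ s, (f i).1 v w :=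
  map_sum (eval v w) f s

end SymForm

/-! ### The coordinate expression of the operator -/

section Symbol

variable {m : ℕ}

/-- The coordinate vector `∂ₖ`. -/
abbrev basisVec (k : Fin m ⊕ Fin m) : Coord m := Pi.single k 1

/-- The vectors dual to the coordinate vectors with respect to `ω`: the Poisson bivector is
`∑ₖ ∂ₖ ⊗ sharp k`. -/
def sharp : Fin m ⊕ Fin m → Coord m :=
  Sum.elim (fun i => Pi.single (Sum.inr i) 1) (fun i => -Pi.single (Sum.inl i) 1)

/-- The Poisson bivector is antisymmetric. -/
theorem sum_sharp_basisVec (B : Coord m →L[ℝ] Coord m →L[ℝ] ℝ) :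
    ∑ k, B (sharp k) (basisVec k) = -∑ k, B (basisVec k) (sharp k) := by
  simp [sharp, Fintype.sum_sum_type, add_comm]

theorem poisson_eq_sum (f g : Coord m → ℝ) (u : Coord m) :
    poisson f g u = ∑ k, fderiv ℝ f u (basisVec k) * fderiv ℝ g u (sharp k) := by
  simp [sharp, Fintype.sum_sum_type, poisson, partialDeriv, basisVec, sub_eq_add_neg,
    Finset.sum_add_distrib]

/-- The part of the operator in which both derivatives fall on the same argument, as a function of
the second derivative `S` of that argument and the value `τ` of the other one.  With indices raised
by the Poisson bivector its quadratic form is `τ_kl S^kl(v, v) + 2 S_v^l(∂ₖ, ∂ₗ) τ(sharp k, v)`,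
where the indices of `S` that are written out are those of the derivatives. -/
def symbolTwo (S : Coord m →L[ℝ] Coord m →L[ℝ] SymForm m) (τ : SymForm m) : SymForm m :=
  ∑ k, ∑ l, (τ.1 (basisVec k) (basisVec l) • S (sharp k) (sharp l) +
    (2 : ℝ) • SymForm.prod ((SymForm.eval (basisVec k) (basisVec l)).comp (S.flip (sharp l)))
      (τ.1 (sharp k)))

/-- The part of the operator in which one derivative falls on each argument, as a function of the
first derivatives `S` and `T`.  The coefficients are forced by invariance, up to a common factor
with `symbolTwo`. -/
def symbolOne (S T : Coord m →L[ℝ] SymForm m) : SymForm m :=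
  ∑ k, ∑ l, ((T (sharp l)).1 (basisVec k) (basisVec l) • S (sharp k) +
    (S (sharp l)).1 (basisVec k) (basisVec l) • T (sharp k) +
    (2 : ℝ) • SymForm.prod ((S (sharp l)).1 (sharp k))
      ((SymForm.eval (basisVec k) (basisVec l)).comp T) +
    (2 : ℝ) • SymForm.prod ((SymForm.eval (basisVec k) (basisVec l)).comp S)
      ((T (sharp l)).1 (sharp k)) -
    (2 : ℝ) • SymForm.prod ((S (basisVec l)).1 (basisVec k)) ((T (sharp l)).1 (sharp k)) -
    (2 : ℝ) • SymForm.prod ((S (sharp l)).1 (basisVec k)) ((T (sharp k)).1 (basisVec l)) -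
    SymForm.prod ((SymForm.eval (basisVec k) (basisVec l)).comp S)
      ((SymForm.eval (sharp k) (sharp l)).comp T))

theorem symbolTwo_apply_self (S : Coord m →L[ℝ] Coord m →L[ℝ] SymForm m) (τ : SymForm m)
    (v : Coord m) :
    (symbolTwo S τ).1 v v =
      ∑ k, ∑ l, (τ.1 (basisVec k) (basisVec l) * (S (sharp k) (sharp l)).1 v v +
        2 * ((S v (sharp l)).1 (basisVec k) (basisVec l) * τ.1 (sharp k) v)) := by
  simp only [symbolTwo, SymForm.sum_apply]
  refine Finset.sum_congr rfl fun k _ => Finset.sum_congr rfl fun l _ => ?_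
  simp only [Submodule.coe_add, Submodule.coe_smul, add_apply,
    smul_apply, SymForm.prod_apply_self, ContinuousLinearMap.comp_apply, SymForm.eval_apply,
    ContinuousLinearMap.flip_apply, smul_eq_mul]

theorem symbolOne_apply_self (S T : Coord m →L[ℝ] SymForm m) (v : Coord m) :
    (symbolOne S T).1 v v =
      ∑ k, ∑ l, ((T (sharp l)).1 (basisVec k) (basisVec l) * (S (sharp k)).1 v v +
        (S (sharp l)).1 (basisVec k) (basisVec l) * (T (sharp k)).1 v v +
        2 * ((S (sharp l)).1 (sharp k) v * (T v).1 (basisVec k) (basisVec l)) +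
        2 * ((S v).1 (basisVec k) (basisVec l) * (T (sharp l)).1 (sharp k) v) -
        2 * ((S (basisVec l)).1 (basisVec k) v * (T (sharp l)).1 (sharp k) v) -
        2 * ((S (sharp l)).1 (basisVec k) v * (T (sharp k)).1 (basisVec l) v) -
        (S v).1 (basisVec k) (basisVec l) * (T v).1 (sharp k) (sharp l)) := by
  simp only [symbolOne, SymForm.sum_apply]
  refine Finset.sum_congr rfl fun k _ => Finset.sum_congr rfl fun l _ => ?_
  simp only [Submodule.coe_add, Submodule.coe_sub, Submodule.coe_smul, add_apply, sub_apply,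
    smul_apply, SymForm.prod_apply_self, ContinuousLinearMap.comp_apply, SymForm.eval_apply,
    smul_eq_mul]

/-- `symbolTwo` as a bilinear map. -/
def symbolTwoₗ (m : ℕ) :
    (Coord m →L[ℝ] Coord m →L[ℝ] SymForm m) →ₗ[ℝ] SymForm m →ₗ[ℝ] SymForm m :=
  LinearMap.mk₂ ℝ symbolTwo
    (fun S S' τ => SymForm.ext_self fun v => by
      simp only [symbolTwo_apply_self, Submodule.coe_add, add_apply,
        ← Finset.sum_add_distrib]
      exact Finset.sum_congr rfl fun k _ => Finset.sum_congr rfl fun l _ => by ring)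
    (fun r S τ => SymForm.ext_self fun v => by
      simp only [symbolTwo_apply_self, Submodule.coe_smul, smul_apply,
        smul_eq_mul, Finset.mul_sum]
      exact Finset.sum_congr rfl fun k _ => Finset.sum_congr rfl fun l _ => by ring)
    (fun S τ τ' => SymForm.ext_self fun v => by
      simp only [symbolTwo_apply_self, Submodule.coe_add, add_apply,
        ← Finset.sum_add_distrib]
      exact Finset.sum_congr rfl fun k _ => Finset.sum_congr rfl fun l _ => by ring)
    (fun r S τ => SymForm.ext_self fun v => by
      simp only [symbolTwo_apply_self, Submodule.coe_smul, smul_apply,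
        smul_eq_mul, Finset.mul_sum]
      exact Finset.sum_congr rfl fun k _ => Finset.sum_congr rfl fun l _ => by ring)

/-- `symbolOne` as a bilinear map. -/
def symbolOneₗ (m : ℕ) :
    (Coord m →L[ℝ] SymForm m) →ₗ[ℝ] (Coord m →L[ℝ] SymForm m) →ₗ[ℝ] SymForm m :=
  LinearMap.mk₂ ℝ symbolOne
    (fun S S' τ => SymForm.ext_self fun v => by
      simp only [symbolOne_apply_self, Submodule.coe_add, add_apply,
        ← Finset.sum_add_distrib]
      exact Finset.sum_congr rfl fun k _ => Finset.sum_congr rfl fun l _ => by ring)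
    (fun r S τ => SymForm.ext_self fun v => by
      simp only [symbolOne_apply_self, Submodule.coe_smul, smul_apply,
        smul_eq_mul, Finset.mul_sum]
      exact Finset.sum_congr rfl fun k _ => Finset.sum_congr rfl fun l _ => by ring)
    (fun S τ τ' => SymForm.ext_self fun v => by
      simp only [symbolOne_apply_self, Submodule.coe_add, add_apply,
        ← Finset.sum_add_distrib]
      exact Finset.sum_congr rfl fun k _ => Finset.sum_congr rfl fun l _ => by ring)
    (fun r S τ => SymForm.ext_self fun v => by
      simp only [symbolOne_apply_self, Submodule.coe_smul, smul_apply,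
        smul_eq_mul, Finset.mul_sum]
      exact Finset.sum_congr rfl fun k _ => Finset.sum_congr rfl fun l _ => by ring)

/-- The coordinate expression of the operator: a bilinear expression in the derivatives of total
order two, with constant coefficients. -/
def gzExpr (s t : Coord m → SymForm m) (u : Coord m) : SymForm m :=
  symbolTwoₗ m (fderiv ℝ (fderiv ℝ s) u) (t u) + symbolOneₗ m (fderiv ℝ s u) (fderiv ℝ t u) +
    symbolTwoₗ m (fderiv ℝ (fderiv ℝ t) u) (s u)

end Symbol

/-! ### Contractions with an antisymmetric bivector -/

section Contraction

variable {ι E : Type*} [Fintype ι] [NormedAddCommGroup E] [NormedSpace ℝ E]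

/-- The contraction of the functional `α` with the bivector `∑ₖ e k ⊗ J k`. -/
def contract (e J : ι → E) (α : E →L[ℝ] ℝ) : E := ∑ k, α (e k) • J k

/-- The bivector `∑ₖ e k ⊗ J k` is antisymmetric. -/
def IsAntisymmBivector (e J : ι → E) : Prop :=
  ∀ B : E →L[ℝ] E →L[ℝ] ℝ, ∑ k, B (J k) (e k) = -∑ k, B (e k) (J k)

variable {e J : ι → E}

theorem sum_mul_eq (α β : E →L[ℝ] ℝ) : ∑ k, α (e k) * β (J k) = β (contract e J α) := by
  simp [contract]

theorem IsAntisymmBivector.sum_mul_eq_neg (h : IsAntisymmBivector e J) (α β : E →L[ℝ] ℝ) :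
    ∑ k, α (J k) * β (e k) = -β (contract e J α) := by
  rw [← sum_mul_eq]
  exact h (α.smulRight β)

theorem IsAntisymmBivector.apply_contract (h : IsAntisymmBivector e J) (α β : E →L[ℝ] ℝ) :
    α (contract e J β) = -β (contract e J α) := by
  rw [← sum_mul_eq, ← h.sum_mul_eq_neg]
  simp only [mul_comm]

/-- The contraction of a symmetric form with an antisymmetric bivector vanishes. -/
theorem IsAntisymmBivector.trace_eq_zero (h : IsAntisymmBivector e J)
    (B : E →L[ℝ] E →L[ℝ] ℝ) (hB : ∀ x y, B x y = B y x) : ∑ k, B (J k) (e k) = 0 := by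
  have h1 := h B
  have h2 : ∑ k, B (e k) (J k) = ∑ k, B (J k) (e k) := Finset.sum_congr rfl fun k _ => hB _ _
  linarith

theorem sum_sum_basis_basis (α β : E →L[ℝ] ℝ) (B : E →L[ℝ] E →L[ℝ] ℝ) :
    ∑ k, ∑ l, α (e k) * β (e l) * B (J k) (J l) = B (contract e J α) (contract e J β) := by
  simp only [mul_assoc, ← Finset.mul_sum, sum_mul_eq]
  exact sum_mul_eq α (B.flip (contract e J β))

theorem IsAntisymmBivector.sum_sum_sharp_basis (h : IsAntisymmBivector e J) (α β : E →L[ℝ] ℝ)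
    (B : E →L[ℝ] E →L[ℝ] ℝ) :
    ∑ k, ∑ l, α (J k) * β (e l) * B (e k) (J l) = -B (contract e J α) (contract e J β) := by
  simp only [mul_assoc, ← Finset.mul_sum, sum_mul_eq]
  exact h.sum_mul_eq_neg α (B.flip (contract e J β))

theorem IsAntisymmBivector.sum_sum_basis_sharp (h : IsAntisymmBivector e J) (α β : E →L[ℝ] ℝ)
    (B : E →L[ℝ] E →L[ℝ] ℝ) :
    ∑ k, ∑ l, α (e k) * β (J l) * B (J k) (e l) = -B (contract e J α) (contract e J β) := by
  simp only [mul_assoc, ← Finset.mul_sum, h.sum_mul_eq_neg, mul_neg, Finset.sum_neg_distrib]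
  rw [neg_inj]
  exact sum_mul_eq α (B.flip (contract e J β))

theorem IsAntisymmBivector.sum_sum_sharp_sharp (h : IsAntisymmBivector e J) (α β : E →L[ℝ] ℝ)
    (B : E →L[ℝ] E →L[ℝ] ℝ) :
    ∑ k, ∑ l, α (J k) * β (J l) * B (e k) (e l) = B (contract e J α) (contract e J β) := by
  simp only [mul_assoc, ← Finset.mul_sum, h.sum_mul_eq_neg, mul_neg, Finset.sum_neg_distrib]
  rw [neg_eq_iff_eq_neg]
  exact h.sum_mul_eq_neg α (B.flip (contract e J β))

theorem sum_sum_mul_mul (α β γ δ : E →L[ℝ] ℝ) :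
    ∑ k, ∑ l, α (e k) * β (J k) * (γ (e l) * δ (J l)) =
      β (contract e J α) * δ (contract e J γ) := by
  rw [← Finset.sum_mul_sum, sum_mul_eq, sum_mul_eq]

end Contraction

/-! ### The symbol on jets of squares of exact forms -/

section Square

variable {ι E : Type*} [Fintype ι] [NormedAddCommGroup E] [NormedSpace ℝ E]
  {e J : ι → E}

/-- The terms of the symbol with both derivatives on `s`, for `s = g²` and `t = p²`, where
`g`, `p` are differentials and `G`, `G₃` the higher derivatives. -/
theorem IsAntisymmBivector.contraction_two (h : IsAntisymmBivector e J) (g p : E →L[ℝ] ℝ)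
    (G : E →L[ℝ] E →L[ℝ] ℝ) (G₃ : E →L[ℝ] E →L[ℝ] E →L[ℝ] ℝ) (hG : ∀ x y, G x y = G y x)
    (hG₃ : ∀ x y z, G₃ x y z = G₃ x z y) (hG₃' : ∀ x y z, G₃ x y z = G₃ y x z) (v : E) :
    ∑ k, ∑ l, (p (e k) * p (e l) *
        (G₃ (J k) (J l) v * g v + G (J l) v * G (J k) v + (G (J k) v * G (J l) v
          + g v * G₃ (J k) (J l) v)) +
      2 * ((G₃ v (J l) (e k) * g (e l) + G (J l) (e k) * G v (e l) + (G v (e k) * G (J l) (e l)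
          + g (e k) * G₃ v (J l) (e l))) * (p (J k) * p v))) =
      2 * g v * G₃ v (contract e J p) (contract e J p) + 2 * G v (contract e J p) ^ 2 -
        2 * p v * (G₃ v (contract e J p) (contract e J g) +
          G (contract e J p) (contract e J (G v))) := by
  have h1 := sum_sum_basis_basis (e := e) (J := J) p p (G₃ v)
  have h2 := sum_sum_mul_mul (e := e) (J := J) p (G v) p (G v)
  have h3 := h.sum_sum_sharp_basis p g (G₃ v)
  have h4 := h.sum_sum_sharp_basis p (G v) G
  have h5 := h.trace_eq_zero G hG
  have h6 := h.trace_eq_zero (G₃ v) (hG₃ v)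
  have h7 : ∑ k, ∑ l, G v (e k) * p (J k) * G (J l) (e l) = 0 := by
    simp only [← Finset.mul_sum, h5, mul_zero, Finset.sum_const_zero]
  have h8 : ∑ k, ∑ l, g (e k) * p (J k) * G₃ v (J l) (e l) = 0 := by
    simp only [← Finset.mul_sum, h6, mul_zero, Finset.sum_const_zero]
  calc _ = 2 * g v * (∑ k, ∑ l, p (e k) * p (e l) * G₃ v (J k) (J l)) +
        2 * (∑ k, ∑ l, p (e k) * G v (J k) * (p (e l) * G v (J l))) +
        2 * p v * (∑ k, ∑ l, p (J k) * g (e l) * G₃ v (e k) (J l)) +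
        2 * p v * (∑ k, ∑ l, p (J k) * G v (e l) * G (e k) (J l)) +
        2 * p v * (∑ k, ∑ l, G v (e k) * p (J k) * G (J l) (e l)) +
        2 * p v * (∑ k, ∑ l, g (e k) * p (J k) * G₃ v (J l) (e l)) := by
        simp only [Finset.mul_sum, ← Finset.sum_add_distrib]
        refine Finset.sum_congr rfl fun k _ => Finset.sum_congr rfl fun l _ => ?_
        rw [hG₃ (J k) (J l) v, hG₃' (J k) v, hG (J l) v, hG (J k) v, hG (J l) (e k),
          hG₃ v (J l) (e k)]
        ring
    _ = _ := by
        rw [h1, h2, h3, h4, h7, h8]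
        ring

/-- The terms of the symbol with one derivative on each argument, for `s = g²` and `t = p²`.  The
contraction of both indices of `G` with those of `P` cancels. -/
theorem IsAntisymmBivector.contraction_one (h : IsAntisymmBivector e J) (g p : E →L[ℝ] ℝ)
    (G P : E →L[ℝ] E →L[ℝ] ℝ) (hG : ∀ x y, G x y = G y x) (hP : ∀ x y, P x y = P y x) (v : E) :
    ∑ k, ∑ l, ((P (J l) (e k) * p (e l) + p (e k) * P (J l) (e l)) *
          (G (J k) v * g v + g v * G (J k) v) +
        (G (J l) (e k) * g (e l) + g (e k) * G (J l) (e l)) *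
          (P (J k) v * p v + p v * P (J k) v) +
        2 * ((G (J l) (J k) * g v + g (J k) * G (J l) v) *
          (P v (e k) * p (e l) + p (e k) * P v (e l))) +
        2 * ((G v (e k) * g (e l) + g (e k) * G v (e l)) *
          (P (J l) (J k) * p v + p (J k) * P (J l) v)) -
        2 * ((G (e l) (e k) * g v + g (e k) * G (e l) v) *
          (P (J l) (J k) * p v + p (J k) * P (J l) v)) -
        2 * ((G (J l) (e k) * g v + g (e k) * G (J l) v) *
          (P (J k) (e l) * p v + p (e l) * P (J k) v)) -
        (G v (e k) * g (e l) + g (e k) * G v (e l)) *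
          (P v (J k) * p (J l) + p (J k) * P v (J l))) =
      4 * g v * G (contract e J p) (contract e J (P v)) +
        4 * p v * P (contract e J g) (contract e J (G v)) -
        2 * g v * P (contract e J p) (contract e J (G v)) -
        2 * p v * G (contract e J g) (contract e J (P v)) -
        4 * G v (contract e J p) * P v (contract e J g) := by
  have c1 := h.sum_sum_sharp_basis (G v) p P
  have c2 := h.sum_sum_sharp_basis (P v) g G
  have c3 := sum_sum_basis_basis (e := e) (J := J) (P v) p G
  have c4 := sum_sum_basis_basis (e := e) (J := J) p (P v) G
  have c5 := sum_sum_basis_basis (e := e) (J := J) (G v) g P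
  have c6 := sum_sum_basis_basis (e := e) (J := J) g (G v) P
  have c7 := h.sum_sum_sharp_sharp p (P v) G
  have c8 := h.sum_sum_sharp_basis (P v) p G
  have c9 := h.sum_sum_basis_sharp g (G v) P
  have d1 := sum_sum_mul_mul (e := e) (J := J) (P v) g p (G v)
  have d2 := sum_sum_mul_mul (e := e) (J := J) p g (P v) (G v)
  have d3 := sum_sum_mul_mul (e := e) (J := J) (G v) p g (P v)
  have d4 := sum_sum_mul_mul (e := e) (J := J) g p (G v) (P v)
  have d5 := sum_sum_mul_mul (e := e) (J := J) g (P v) p (G v)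
  have z1 : ∑ k, ∑ l, p (e k) * G v (J k) * P (J l) (e l) = 0 := by
    simp only [← Finset.mul_sum, h.trace_eq_zero P hP, mul_zero, Finset.sum_const_zero]
  have z2 : ∑ k, ∑ l, g (e k) * P v (J k) * G (J l) (e l) = 0 := by
    simp only [← Finset.mul_sum, h.trace_eq_zero G hG, mul_zero, Finset.sum_const_zero]
  have tr : ∑ k, ∑ l, G (J l) (e k) * P (e l) (J k) = -∑ k, ∑ l, G (e l) (e k) * P (J l) (J k) := by
    rw [← Finset.sum_neg_distrib]
    exact Finset.sum_congr rfl fun k _ => h ((G.flip (e k)).smulRight (P.flip (J k)))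
  calc _ = 2 * g v * (∑ k, ∑ l, G v (J k) * p (e l) * P (e k) (J l)) +
        2 * g v * (∑ k, ∑ l, p (e k) * G v (J k) * P (J l) (e l)) +
        2 * p v * (∑ k, ∑ l, P v (J k) * g (e l) * G (e k) (J l)) +
        2 * p v * (∑ k, ∑ l, g (e k) * P v (J k) * G (J l) (e l)) +
        2 * g v * (∑ k, ∑ l, P v (e k) * p (e l) * G (J k) (J l)) +
        2 * g v * (∑ k, ∑ l, p (e k) * P v (e l) * G (J k) (J l)) +
        2 * (∑ k, ∑ l, P v (e k) * g (J k) * (p (e l) * G v (J l))) +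
        2 * (∑ k, ∑ l, p (e k) * g (J k) * (P v (e l) * G v (J l))) +
        2 * p v * (∑ k, ∑ l, G v (e k) * g (e l) * P (J k) (J l)) +
        (∑ k, ∑ l, G v (e k) * p (J k) * (g (e l) * P v (J l))) +
        2 * p v * (∑ k, ∑ l, g (e k) * G v (e l) * P (J k) (J l)) +
        (-1) * (∑ k, ∑ l, g (e k) * p (J k) * (G v (e l) * P v (J l))) +
        (-2) * (g v * p v) * (∑ k, ∑ l, G (e l) (e k) * P (J l) (J k)) +
        (-2) * g v * (∑ k, ∑ l, p (J k) * P v (J l) * G (e k) (e l)) +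
        (-2) * p v * (∑ k, ∑ l, g (e k) * G v (e l) * P (J k) (J l)) +
        (-2) * (g v * p v) * (∑ k, ∑ l, G (J l) (e k) * P (e l) (J k)) +
        (-2) * g v * (∑ k, ∑ l, P v (J k) * p (e l) * G (e k) (J l)) +
        (-2) * p v * (∑ k, ∑ l, g (e k) * G v (J l) * P (J k) (e l)) +
        (-2) * (∑ k, ∑ l, g (e k) * P v (J k) * (p (e l) * G v (J l))) +
        (-1) * (∑ k, ∑ l, G v (e k) * P v (J k) * (g (e l) * p (J l))) +
        (-1) * (∑ k, ∑ l, g (e k) * P v (J k) * (G v (e l) * p (J l))) := by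
        simp only [Finset.mul_sum, ← Finset.sum_add_distrib]
        refine Finset.sum_congr rfl fun k _ => Finset.sum_congr rfl fun l _ => ?_
        rw [hG (J l) v, hG (J k) v, hG (J l) (J k), hG (e l) v, hG (e l) (e k), hG (J l) (e k),
          hP (J l) v, hP (J k) v, hP (J l) (J k), hP (J l) (e k), hP (e l) (J k)]
        ring
    _ = _ := by
        have d6 := sum_sum_mul_mul (e := e) (J := J) (G v) (P v) g p
        have d7 := sum_sum_mul_mul (e := e) (J := J) g (P v) (G v) p
        rw [c1, c2, c3, c4, c5, c6, c7, c8, c9, d1, d2, d3, d4, d5, d6, d7, z1, z2, tr,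
          h.apply_contract g (P v), h.apply_contract p (G v), h.apply_contract g p,
          h.apply_contract (P v) (G v), hP (contract e J (G v)) (contract e J g),
          hP (contract e J (G v)) (contract e J p),
          hG (contract e J (P v)) (contract e J g), hG (contract e J (P v)) (contract e J p)]
        ring

end Square

/-! ### Jets of fields of symmetric forms -/

section Jets

variable {m : ℕ}

/-- The symmetric product of functionals as a continuous bilinear map. -/
def SymForm.prodL (m : ℕ) : (Coord m →L[ℝ] ℝ) →L[ℝ] (Coord m →L[ℝ] ℝ) →L[ℝ] SymForm m :=
  LinearMap.toContinuousBilinearMap <| LinearMap.mk₂ ℝ SymForm.prod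
    (fun _ _ _ => SymForm.ext_self fun v => by simp [add_mul])
    (fun _ _ _ => SymForm.ext_self fun v => by simp [mul_assoc])
    (fun _ _ _ => SymForm.ext_self fun v => by simp [mul_add])
    (fun _ _ _ => SymForm.ext_self fun v => by simp [mul_left_comm])

theorem ContDiffAt.symForm_prod {n : WithTop ℕ∞} {α β : Coord m → Coord m →L[ℝ] ℝ} {u : Coord m}
    (hα : ContDiffAt ℝ n α u) (hβ : ContDiffAt ℝ n β u) :
    ContDiffAt ℝ n (fun x => SymForm.prod (α x) (β x)) u :=
  ((SymForm.prodL m).contDiff.contDiffAt.comp u hα).clm_apply hβ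

/-- A smooth function germ is differentiable near the point. -/
theorem ContDiffAt.eventually_differentiableAt {E F : Type*} [NormedAddCommGroup E]
    [NormedSpace ℝ E] [NormedAddCommGroup F] [NormedSpace ℝ F] {f : E → F} {u : E}
    (hf : ContDiffAt ℝ ∞ f u) : ∀ᶠ x in 𝓝 u, DifferentiableAt ℝ f x := by
  have h1 : ContDiffAt ℝ 1 f u := hf.of_le (by exact_mod_cast le_top)
  filter_upwards [h1.eventually (by simp)] with x hx
  exact hx.differentiableAt (by simp)

theorem ContDiffAt.fderiv_infty {E F : Type*} [NormedAddCommGroup E]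
    [NormedSpace ℝ E] [NormedAddCommGroup F] [NormedSpace ℝ F] {f : E → F} {u : E}
    (hf : ContDiffAt ℝ ∞ f u) : ContDiffAt ℝ ∞ (fderiv ℝ f) u :=
  hf.fderiv_right (by simp)

theorem ContDiffAt.differentiableAt_infty {E F : Type*} [NormedAddCommGroup E]
    [NormedSpace ℝ E] [NormedAddCommGroup F] [NormedSpace ℝ F] {f : E → F} {u : E}
    (hf : ContDiffAt ℝ ∞ f u) : DifferentiableAt ℝ f u :=
  hf.differentiableAt (by simp)

theorem fderiv_clm_apply_const {E F G : Type*} [NormedAddCommGroup E]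
    [NormedSpace ℝ E] [NormedAddCommGroup F] [NormedSpace ℝ F] [NormedAddCommGroup G]
    [NormedSpace ℝ G] {f : E → F →L[ℝ] G} {u : E} (hf : DifferentiableAt ℝ f u) (y : E) (v : F) :
    fderiv ℝ (fun x => f x v) u y = fderiv ℝ f u y v := by
  rw [fderiv_clm_apply hf (differentiableAt_const v)]
  simp

theorem fderiv_form_apply {s : Coord m → SymForm m} {u : Coord m} (hs : DifferentiableAt ℝ s u)
    (y v w : Coord m) :
    (fderiv ℝ s u y).1 v w = fderiv ℝ (fun x => (s x).1 v w) u y := by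
  have h := ((SymForm.eval v w).hasFDerivAt.comp u hs.hasFDerivAt).fderiv
  exact (congrArg (fun L : Coord m →L[ℝ] ℝ => L y) h).symm

theorem fderiv_fderiv_form_apply {s : Coord m → SymForm m} {u : Coord m}
    (hs : ContDiffAt ℝ ∞ s u) (y z v w : Coord m) :
    (fderiv ℝ (fderiv ℝ s) u y z).1 v w =
      fderiv ℝ (fun x => fderiv ℝ (fun x' => (s x').1 v w) x z) u y := by
  have h1 : (fun x => fderiv ℝ (fun x' => (s x').1 v w) x z) =ᶠ[𝓝 u]
      fun x => (fderiv ℝ s x z).1 v w := by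
    filter_upwards [hs.eventually_differentiableAt] with x hx
    exact (fderiv_form_apply hx z v w).symm
  have h2 : DifferentiableAt ℝ (fderiv ℝ s) u := hs.fderiv_infty.differentiableAt_infty
  have h3 : DifferentiableAt ℝ (fun x => fderiv ℝ s x z) u :=
    h2.clm_apply (differentiableAt_const z)
  rw [h1.fderiv_eq, ← fderiv_form_apply h3, fderiv_clm_apply_const h2]

/-- The square `(dg)²` of the differential of a function. -/
def sqDiff (g : Coord m → ℝ) (x : Coord m) : SymForm m :=
  SymForm.prod (fderiv ℝ g x) (fderiv ℝ g x)

theorem sqDiff_apply (g : Coord m → ℝ) (x v w : Coord m) :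
    (sqDiff g x).1 v w = fderiv ℝ g x v * fderiv ℝ g x w := by
  rw [sqDiff, SymForm.prod_apply]
  ring

theorem ContDiffAt.sqDiff {g : Coord m → ℝ} {u : Coord m} (hg : ContDiffAt ℝ ∞ g u) :
    ContDiffAt ℝ ∞ (sqDiff g) u :=
  hg.fderiv_infty.symForm_prod hg.fderiv_infty

theorem fderiv_mul_apply {E : Type*} [NormedAddCommGroup E] [NormedSpace ℝ E] {a b : E → ℝ} {u : E}
    (ha : DifferentiableAt ℝ a u) (hb : DifferentiableAt ℝ b u) (y : E) :
    fderiv ℝ (fun x => a x * b x) u y = fderiv ℝ a u y * b u + a u * fderiv ℝ b u y := by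
  rw [fderiv_fun_mul ha hb]
  simp
  ring

theorem fderiv_sqDiff_apply {g : Coord m → ℝ} {u : Coord m}
    (h : DifferentiableAt ℝ (fderiv ℝ g) u) (z v w : Coord m) :
    (fderiv ℝ (sqDiff g) u z).1 v w =
      fderiv ℝ (fderiv ℝ g) u z v * fderiv ℝ g u w +
        fderiv ℝ g u v * fderiv ℝ (fderiv ℝ g) u z w := by
  have hs : DifferentiableAt ℝ (sqDiff g) u :=
    ((SymForm.prodL m).differentiableAt.comp u h).clm_apply h
  rw [fderiv_form_apply hs]
  simp only [sqDiff_apply]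
  rw [fderiv_mul_apply (h.clm_apply (differentiableAt_const v))
    (h.clm_apply (differentiableAt_const w)), fderiv_clm_apply_const h, fderiv_clm_apply_const h]

theorem fderiv_fderiv_sqDiff_apply {g : Coord m → ℝ} {u : Coord m} (hg : ContDiffAt ℝ ∞ g u)
    (y z v w : Coord m) :
    (fderiv ℝ (fderiv ℝ (sqDiff g)) u y z).1 v w =
      fderiv ℝ (fderiv ℝ (fderiv ℝ g)) u y z v * fderiv ℝ g u w +
        fderiv ℝ (fderiv ℝ g) u z v * fderiv ℝ (fderiv ℝ g) u y w +
      (fderiv ℝ (fderiv ℝ g) u y v * fderiv ℝ (fderiv ℝ g) u z w +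
        fderiv ℝ g u v * fderiv ℝ (fderiv ℝ (fderiv ℝ g)) u y z w) := by
  have h1 := hg.fderiv_infty
  have h2 := h1.fderiv_infty
  have d1 := h1.differentiableAt_infty
  have d2 := h2.differentiableAt_infty
  have d2' : ∀ z, DifferentiableAt ℝ (fun x => fderiv ℝ (fderiv ℝ g) x z) u :=
    fun z => d2.clm_apply (differentiableAt_const z)
  have e : (fun x => (fderiv ℝ (sqDiff g) x z).1 v w) =ᶠ[𝓝 u]
      fun x => fderiv ℝ (fderiv ℝ g) x z v * fderiv ℝ g x w +
        fderiv ℝ g x v * fderiv ℝ (fderiv ℝ g) x z w := by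
    filter_upwards [h1.eventually_differentiableAt] with x hx
    exact fderiv_sqDiff_apply hx z v w
  have d3 : DifferentiableAt ℝ (fderiv ℝ (sqDiff g)) u :=
    hg.sqDiff.fderiv_infty.differentiableAt_infty
  have d3' : DifferentiableAt ℝ (fun x => fderiv ℝ (sqDiff g) x z) u :=
    d3.clm_apply (differentiableAt_const z)
  have a1 : ∀ v, DifferentiableAt ℝ (fun x => fderiv ℝ g x v) u :=
    fun v => d1.clm_apply (differentiableAt_const v)
  have a2 : ∀ v, DifferentiableAt ℝ (fun x => fderiv ℝ (fderiv ℝ g) x z v) u :=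
    fun v => (d2' z).clm_apply (differentiableAt_const v)
  rw [← fderiv_clm_apply_const d3, fderiv_form_apply d3', e.fderiv_eq,
    fderiv_fun_add ((a2 v).fun_mul (a1 w)) ((a1 v).fun_mul (a2 w)), add_apply,
    fderiv_mul_apply (a2 v) (a1 w), fderiv_mul_apply (a1 v) (a2 w),
    fderiv_clm_apply_const (d2' z), fderiv_clm_apply_const (d2' z), fderiv_clm_apply_const d1,
    fderiv_clm_apply_const d1, fderiv_clm_apply_const d2]

end Jets

/-! ### Poisson brackets -/

section Poisson

variable {m : ℕ}

/-- The Poisson bivector as a map from covectors to vectors: `dg` is sent to the vector field `X`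
with `X f = {g, f}`. -/
def hamVec (m : ℕ) : (Coord m →L[ℝ] ℝ) →L[ℝ] Coord m :=
  ∑ k, (ContinuousLinearMap.apply ℝ ℝ (basisVec k)).smulRight (sharp k)

theorem hamVec_apply (α : Coord m →L[ℝ] ℝ) : hamVec m α = contract basisVec sharp α := by
  simp [hamVec, contract]

theorem isAntisymmBivector_sharp : IsAntisymmBivector (basisVec (m := m)) sharp :=
  sum_sharp_basisVec

theorem poisson_eq (f g : Coord m → ℝ) (u : Coord m) :
    poisson f g u = fderiv ℝ g u (hamVec m (fderiv ℝ f u)) := by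
  rw [poisson_eq_sum, hamVec_apply, sum_mul_eq]

theorem apply_hamVec (α β : Coord m →L[ℝ] ℝ) : α (hamVec m β) = -β (hamVec m α) := by
  rw [hamVec_apply, hamVec_apply, isAntisymmBivector_sharp.apply_contract]

theorem ContDiffAt.poisson {f g : Coord m → ℝ} {u : Coord m} (hf : ContDiffAt ℝ ∞ f u)
    (hg : ContDiffAt ℝ ∞ g u) : ContDiffAt ℝ ∞ (poisson f g) u := by
  have : _root_.poisson f g = fun x => fderiv ℝ g x (hamVec m (fderiv ℝ f x)) :=
    funext (poisson_eq f g)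
  rw [this]
  exact hg.fderiv_infty.clm_apply ((hamVec m).contDiff.contDiffAt.comp u hf.fderiv_infty)

/-- The derivative of `{f, g}`; the sign comes from moving `hamVec` to the other factor. -/
theorem fderiv_poisson {f g : Coord m → ℝ} {u : Coord m}
    (hf : DifferentiableAt ℝ (fderiv ℝ f) u) (hg : DifferentiableAt ℝ (fderiv ℝ g) u)
    (z : Coord m) :
    fderiv ℝ (poisson f g) u z =
      fderiv ℝ (fderiv ℝ g) u z (hamVec m (fderiv ℝ f u)) -
        fderiv ℝ (fderiv ℝ f) u z (hamVec m (fderiv ℝ g u)) := by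
  have : poisson f g = fun x => fderiv ℝ g x (hamVec m (fderiv ℝ f x)) :=
    funext (poisson_eq f g)
  have h : HasFDerivAt (fun x => hamVec m (fderiv ℝ f x))
      ((hamVec m).comp (fderiv ℝ (fderiv ℝ f) u)) u :=
    (hamVec m).hasFDerivAt.comp u hf.hasFDerivAt
  rw [this, fderiv_clm_apply hg h.differentiableAt, h.fderiv]
  simp [apply_hamVec (fderiv ℝ g u)]
  ring

theorem fderiv_fderiv_poisson {f g : Coord m → ℝ} {u : Coord m}
    (hf : ContDiffAt ℝ ∞ f u) (hg : ContDiffAt ℝ ∞ g u) (y z : Coord m) :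
    fderiv ℝ (fderiv ℝ (poisson f g)) u y z =
      fderiv ℝ (fderiv ℝ (fderiv ℝ g)) u y z (hamVec m (fderiv ℝ f u)) +
        fderiv ℝ (fderiv ℝ g) u z (hamVec m (fderiv ℝ (fderiv ℝ f) u y)) -
      (fderiv ℝ (fderiv ℝ (fderiv ℝ f)) u y z (hamVec m (fderiv ℝ g u)) +
        fderiv ℝ (fderiv ℝ f) u z (hamVec m (fderiv ℝ (fderiv ℝ g) u y))) := by
  have aux : ∀ {p q : Coord m → ℝ}, ContDiffAt ℝ ∞ p u → ContDiffAt ℝ ∞ q u →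
      HasFDerivAt (fun x => fderiv ℝ (fderiv ℝ p) x z (hamVec m (fderiv ℝ q x)))
        ((fderiv ℝ (fderiv ℝ p) u z).comp ((hamVec m).comp (fderiv ℝ (fderiv ℝ q) u)) +
          (fderiv ℝ (fun x => fderiv ℝ (fderiv ℝ p) x z) u).flip
            (hamVec m (fderiv ℝ q u))) u := by
    intro p q hp hq
    have hp2 := hp.fderiv_infty.fderiv_infty.differentiableAt_infty
    have h : HasFDerivAt (fun x => hamVec m (fderiv ℝ q x))
        ((hamVec m).comp (fderiv ℝ (fderiv ℝ q) u)) u :=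
      (hamVec m).hasFDerivAt.comp u hq.fderiv_infty.differentiableAt_infty.hasFDerivAt
    exact (hp2.clm_apply (differentiableAt_const z)).hasFDerivAt.clm_apply h
  have e : (fun x => fderiv ℝ (poisson f g) x z) =ᶠ[𝓝 u] fun x =>
      fderiv ℝ (fderiv ℝ g) x z (hamVec m (fderiv ℝ f x)) -
        fderiv ℝ (fderiv ℝ f) x z (hamVec m (fderiv ℝ g x)) := by
    filter_upwards [hf.fderiv_infty.eventually_differentiableAt,
      hg.fderiv_infty.eventually_differentiableAt] with x h1 h2
    exact fderiv_poisson h1 h2 z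
  rw [← fderiv_clm_apply_const (hf.poisson hg).fderiv_infty.differentiableAt_infty, e.fderiv_eq,
    ((aux hg hf).fun_sub (aux hf hg)).fderiv]
  simp [fderiv_clm_apply_const hf.fderiv_infty.fderiv_infty.differentiableAt_infty,
    fderiv_clm_apply_const hg.fderiv_infty.fderiv_infty.differentiableAt_infty]
  ring

end Poisson

/-! ### The operator on squares of differentials -/

section GzSquare

variable {m : ℕ}

theorem two_le_infty : (2 : WithTop ℕ∞) ≤ ∞ := WithTop.coe_le_coe.2 le_top

theorem fderiv_fderiv_symm {g : Coord m → ℝ} {u : Coord m} (hg : ContDiffAt ℝ ∞ g u)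
    (x y : Coord m) : fderiv ℝ (fderiv ℝ g) u x y = fderiv ℝ (fderiv ℝ g) u y x :=
  (hg.isSymmSndFDerivAt (by simpa using two_le_infty)) x y

theorem fderiv_fderiv_fderiv_symm_left {g : Coord m → ℝ} {u : Coord m} (hg : ContDiffAt ℝ ∞ g u)
    (x y z : Coord m) :
    fderiv ℝ (fderiv ℝ (fderiv ℝ g)) u x y z = fderiv ℝ (fderiv ℝ (fderiv ℝ g)) u y x z :=
  congrArg (fun L : Coord m →L[ℝ] ℝ => L z)
    (hg.fderiv_infty.isSymmSndFDerivAt (by simpa using two_le_infty) x y)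

theorem fderiv_fderiv_fderiv_symm_right {g : Coord m → ℝ} {u : Coord m} (hg : ContDiffAt ℝ ∞ g u)
    (x y z : Coord m) :
    fderiv ℝ (fderiv ℝ (fderiv ℝ g)) u x y z = fderiv ℝ (fderiv ℝ (fderiv ℝ g)) u x z y := by
  have h := hg.fderiv_infty.fderiv_infty.differentiableAt_infty
  have key : ∀ y z, fderiv ℝ (fun w => fderiv ℝ (fderiv ℝ g) w y z) u x =
      fderiv ℝ (fderiv ℝ (fderiv ℝ g)) u x y z := fun y z => by
    rw [fderiv_clm_apply_const (h.clm_apply (differentiableAt_const y)), fderiv_clm_apply_const h]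
  have h2 : ContDiffAt ℝ 2 g u := hg.of_le two_le_infty
  have e : (fun w => fderiv ℝ (fderiv ℝ g) w y z) =ᶠ[𝓝 u] fun w => fderiv ℝ (fderiv ℝ g) w z y := by
    filter_upwards [h2.eventually (by simp)] with w hw
    exact hw.isSymmSndFDerivAt (by simp) y z
  rw [← key, ← key, e.fderiv_eq]

/-- On the squares of two exact forms the operator is given by Poisson brackets and differentials
alone: it is `2 ((d{g, p})² + d{g, {g, p}} dp + d{p, {p, g}} dg)`. -/
theorem gzExpr_sqDiff {g p : Coord m → ℝ} {u : Coord m} (hg : ContDiffAt ℝ ∞ g u)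
    (hp : ContDiffAt ℝ ∞ p u) (v : Coord m) :
    (gzExpr (sqDiff g) (sqDiff p) u).1 v v =
      2 * (fderiv ℝ (poisson g p) u v ^ 2 +
        fderiv ℝ (poisson g (poisson g p)) u v * fderiv ℝ p u v +
        fderiv ℝ (poisson p (poisson p g)) u v * fderiv ℝ g u v) := by
  have hG := fderiv_fderiv_symm hg
  have hP := fderiv_fderiv_symm hp
  have t1 := isAntisymmBivector_sharp.contraction_two (fderiv ℝ g u) (fderiv ℝ p u)
    (fderiv ℝ (fderiv ℝ g) u) (fderiv ℝ (fderiv ℝ (fderiv ℝ g)) u) hG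
    (fderiv_fderiv_fderiv_symm_right hg) (fderiv_fderiv_fderiv_symm_left hg) v
  have t2 := isAntisymmBivector_sharp.contraction_two (fderiv ℝ p u) (fderiv ℝ g u)
    (fderiv ℝ (fderiv ℝ p) u) (fderiv ℝ (fderiv ℝ (fderiv ℝ p)) u) hP
    (fderiv_fderiv_fderiv_symm_right hp) (fderiv_fderiv_fderiv_symm_left hp) v
  have t3 := isAntisymmBivector_sharp.contraction_one (fderiv ℝ g u) (fderiv ℝ p u)
    (fderiv ℝ (fderiv ℝ g) u) (fderiv ℝ (fderiv ℝ p) u) hG hP v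
  have split : (gzExpr (sqDiff g) (sqDiff p) u).1 v v =
      (symbolTwo (m := m) (fderiv ℝ (fderiv ℝ (sqDiff g)) u) (sqDiff p u)).1 v v +
      (symbolOne (m := m) (fderiv ℝ (sqDiff g) u) (fderiv ℝ (sqDiff p) u)).1 v v +
      (symbolTwo (m := m) (fderiv ℝ (fderiv ℝ (sqDiff p)) u) (sqDiff g u)).1 v v := rfl
  rw [split, symbolTwo_apply_self (m := m), symbolTwo_apply_self (m := m),
    symbolOne_apply_self (m := m)]
  simp only [sqDiff_apply, fderiv_sqDiff_apply hg.fderiv_infty.differentiableAt_infty,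
    fderiv_sqDiff_apply hp.fderiv_infty.differentiableAt_infty,
    fderiv_fderiv_sqDiff_apply hg, fderiv_fderiv_sqDiff_apply hp]
  rw [t1, t2, t3]
  simp only [← hamVec_apply]
  have d1 := hg.fderiv_infty.differentiableAt_infty
  have d2 := hp.fderiv_infty.differentiableAt_infty
  rw [fderiv_poisson d1 (hg.poisson hp).fderiv_infty.differentiableAt_infty,
    fderiv_poisson d2 (hp.poisson hg).fderiv_infty.differentiableAt_infty,
    fderiv_fderiv_poisson hg hp, fderiv_fderiv_poisson hp hg,
    apply_hamVec _ (fderiv ℝ (poisson g p) u), apply_hamVec _ (fderiv ℝ (poisson p g) u)]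
  simp only [fderiv_poisson d1 d2, fderiv_poisson d2 d1]
  -- Both sides are now polynomials in the contracted derivatives, up to the order of arguments.
  simp only [hG _ (hamVec m (fderiv ℝ (fderiv ℝ g) u v)),
    hP _ (hamVec m (fderiv ℝ (fderiv ℝ p) u v)), hG _ (hamVec m (fderiv ℝ (fderiv ℝ p) u v)),
    hP _ (hamVec m (fderiv ℝ (fderiv ℝ g) u v)),
    fderiv_fderiv_fderiv_symm_right hg v (hamVec m (fderiv ℝ p u)) (hamVec m (fderiv ℝ g u)),
    fderiv_fderiv_fderiv_symm_right hp v (hamVec m (fderiv ℝ p u)) (hamVec m (fderiv ℝ g u))]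
  ring

end GzSquare

/-! ### Decomposition of symmetric forms into squares -/

section Decomposition

variable {m : ℕ}

/-- The coordinate expansion of a symmetric form. -/
theorem SymForm.eq_sum_prod (b : SymForm m) :
    b = ∑ i, ∑ j, b.1 (basisVec i) (basisVec j) •
      SymForm.prod (ContinuousLinearMap.proj i) (ContinuousLinearMap.proj j) := by
  apply SymForm.ext_self
  intro v
  have hv : v = ∑ i, v i • basisVec i := by
    ext k
    simp [basisVec, Finset.sum_apply, Pi.single_apply]
  have h1 : ∀ w, b.1 v w = ∑ i, v i * b.1 (basisVec i) w := fun w => by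
    conv_lhs => rw [hv]
    simp [map_sum]
  have h2 : ∀ w, b.1 w v = ∑ i, v i * b.1 w (basisVec i) := fun w => by
    rw [b.2, h1]
    exact Finset.sum_congr rfl fun i _ => by rw [b.2]
  rw [h1]
  simp only [SymForm.sum_apply]
  refine Finset.sum_congr rfl fun i _ => ?_
  rw [h2, Finset.mul_sum]
  refine Finset.sum_congr rfl fun j _ => ?_
  simp
  ring

theorem ContDiffAt.symForm_of_apply {s : Coord m → SymForm m} {u : Coord m} {n : WithTop ℕ∞}
    (h : ∀ v w, ContDiffAt ℝ n (fun x => (s x).1 v w) u) : ContDiffAt ℝ n s u := by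
  have : s = fun x => ∑ i, ∑ j, (s x).1 (basisVec i) (basisVec j) •
      SymForm.prod (ContinuousLinearMap.proj i) (ContinuousLinearMap.proj j) :=
    funext fun x => SymForm.eq_sum_prod (s x)
  rw [this]
  exact ContDiffAt.sum fun i _ => ContDiffAt.sum fun j _ => (h _ _).smul contDiffAt_const

theorem ContDiffAt.symForm_apply {s : Coord m → SymForm m} {u : Coord m} {n : WithTop ℕ∞}
    (h : ContDiffAt ℝ n s u) (v w : Coord m) : ContDiffAt ℝ n (fun x => (s x).1 v w) u :=
  (SymForm.eval v w).contDiff.contDiffAt.comp u h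

/-- A property of germs of fields of symmetric forms that is stable under linear combinations and
holds for all squares `(dg)²` holds for all smooth fields.  The reason is the identity
`2 f dg dh = d(fg) dh + d(fh) dg - d(gh) df` together with polarization. -/
theorem SymForm.field_induction {u : Coord m} {P : (Coord m → SymForm m) → Prop}
    (sq : ∀ g, ContDiffAt ℝ ∞ g u → P (sqDiff g))
    (add : ∀ s t, ContDiffAt ℝ ∞ s u → ContDiffAt ℝ ∞ t u → P s → P t → P (s + t))
    (smul : ∀ (c : ℝ) s, ContDiffAt ℝ ∞ s u → P s → P (c • s))
    (congr : ∀ s t, s =ᶠ[𝓝 u] t → P s → P t)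
    {s : Coord m → SymForm m} (hs : ContDiffAt ℝ ∞ s u) : P s := by
  let Q : (Coord m → SymForm m) → Prop := fun s => ContDiffAt ℝ ∞ s u ∧ P s
  have Qadd : ∀ s t, Q s → Q t → Q (s + t) := fun s t h h' =>
    ⟨h.1.add h'.1, add s t h.1 h'.1 h.2 h'.2⟩
  have Qsmul : ∀ (c : ℝ) s, Q s → Q (c • s) := fun c s h =>
    ⟨contDiffAt_const.smul h.1, smul c s h.1 h.2⟩
  have Qcongr : ∀ s t, s =ᶠ[𝓝 u] t → Q s → Q t := fun s t e h =>
    ⟨h.1.congr_of_eventuallyEq e.symm, congr s t e h.2⟩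
  have Qprod : ∀ g h : Coord m → ℝ, ContDiffAt ℝ ∞ g u → ContDiffAt ℝ ∞ h u →
      Q (fun x => SymForm.prod (fderiv ℝ g x) (fderiv ℝ h x)) := by
    intro g h hg hh
    refine Qcongr ((1 / 4 : ℝ) • sqDiff (g + h) + (-1 / 4 : ℝ) • sqDiff (g - h)) _ ?_
      (Qadd _ _ (Qsmul _ _ ⟨(hg.add hh).sqDiff, sq _ (hg.add hh)⟩)
        (Qsmul _ _ ⟨(hg.sub hh).sqDiff, sq _ (hg.sub hh)⟩))
    filter_upwards [hg.eventually_differentiableAt, hh.eventually_differentiableAt] with x h1 h2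
    apply SymForm.ext_self
    intro v
    simp [sqDiff_apply, fderiv_add h1 h2, fderiv_sub h1 h2]
    ring
  have Qmul : ∀ f g h : Coord m → ℝ, ContDiffAt ℝ ∞ f u → ContDiffAt ℝ ∞ g u →
      ContDiffAt ℝ ∞ h u →
      Q (fun x => f x • SymForm.prod (fderiv ℝ g x) (fderiv ℝ h x)) := by
    intro f g h hf hg hh
    refine Qcongr ((1 / 2 : ℝ) • (fun x => SymForm.prod (fderiv ℝ (f * g) x) (fderiv ℝ h x)) +
      ((1 / 2 : ℝ) • (fun x => SymForm.prod (fderiv ℝ (f * h) x) (fderiv ℝ g x)) +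
        (-1 / 2 : ℝ) • (fun x => SymForm.prod (fderiv ℝ (g * h) x) (fderiv ℝ f x)))) _ ?_
      (Qadd _ _ (Qsmul _ _ (Qprod _ _ (hf.mul hg) hh)) (Qadd _ _
        (Qsmul _ _ (Qprod _ _ (hf.mul hh) hg)) (Qsmul _ _ (Qprod _ _ (hg.mul hh) hf))))
    filter_upwards [hf.eventually_differentiableAt, hg.eventually_differentiableAt,
      hh.eventually_differentiableAt] with x h1 h2 h3
    apply SymForm.ext_self
    intro v
    simp [fderiv_mul h1 h2, fderiv_mul h1 h3, fderiv_mul h2 h3]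
    ring
  have Qsum : ∀ (ι : Type) (S : Finset ι) (f : ι → Coord m → SymForm m), (∀ i, Q (f i)) →
      Q (∑ i ∈ S, f i) := by
    intro ι S f hf
    induction S using Finset.cons_induction with
    | empty =>
      rw [Finset.sum_empty]
      refine Qcongr ((0 : ℝ) • sqDiff (fun _ => 0)) 0 (by simp) (Qsmul _ _ ?_)
      exact ⟨(contDiffAt_const (c := (0 : ℝ))).sqDiff, sq _ contDiffAt_const⟩
    | cons i S hi ih =>
      rw [Finset.sum_cons]
      exact Qadd _ _ (hf i) ih
  have key : Q (∑ i, ∑ j, fun x => (s x).1 (basisVec i) (basisVec j) •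
      SymForm.prod (fderiv ℝ (fun y : Coord m => y i) x) (fderiv ℝ (fun y : Coord m => y j) x)) :=
    Qsum _ _ _ fun i => Qsum _ _ _ fun j => Qmul _ _ _ (hs.symForm_apply _ _)
      (contDiff_apply ℝ ℝ i).contDiffAt (contDiff_apply ℝ ℝ j).contDiffAt
  refine (Qcongr _ s (Filter.Eventually.of_forall fun x => ?_) key).2
  have hproj : ∀ i, fderiv ℝ (fun y : Coord m => y i) x = ContinuousLinearMap.proj i := fun i =>
    (ContinuousLinearMap.proj (R := ℝ) (φ := fun _ : Fin m ⊕ Fin m => ℝ) i).fderiv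
  simp only [Finset.sum_apply, hproj]
  exact (SymForm.eq_sum_prod (s x)).symm

end Decomposition

/-! ### Invariance of the coordinate expression -/

section Invariance

variable {m : ℕ}

theorem ContDiffAt.fderiv_fderiv_add {E F : Type*} [NormedAddCommGroup E] [NormedSpace ℝ E]
    [NormedAddCommGroup F] [NormedSpace ℝ F] {s t : E → F} {u : E} (hs : ContDiffAt ℝ ∞ s u)
    (ht : ContDiffAt ℝ ∞ t u) :
    fderiv ℝ (fderiv ℝ (s + t)) u = fderiv ℝ (fderiv ℝ s) u + fderiv ℝ (fderiv ℝ t) u := by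
  have e : fderiv ℝ (s + t) =ᶠ[𝓝 u] fderiv ℝ s + fderiv ℝ t := by
    filter_upwards [hs.eventually_differentiableAt, ht.eventually_differentiableAt] with x h h'
    exact fderiv_add h h'
  rw [e.fderiv_eq,
    fderiv_add hs.fderiv_infty.differentiableAt_infty ht.fderiv_infty.differentiableAt_infty]

theorem ContDiffAt.fderiv_fderiv_const_smul {E F : Type*} [NormedAddCommGroup E] [NormedSpace ℝ E]
    [NormedAddCommGroup F] [NormedSpace ℝ F] {s : E → F} {u : E} (c : ℝ)
    (hs : ContDiffAt ℝ ∞ s u) :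
    fderiv ℝ (fderiv ℝ (c • s)) u = c • fderiv ℝ (fderiv ℝ s) u := by
  have e : fderiv ℝ (c • s) =ᶠ[𝓝 u] c • fderiv ℝ s := by
    filter_upwards [hs.eventually_differentiableAt] with x h
    exact fderiv_const_smul h c
  rw [e.fderiv_eq, fderiv_const_smul hs.fderiv_infty.differentiableAt_infty]

theorem gzExpr_add_left {s s' t : Coord m → SymForm m} {u : Coord m} (hs : ContDiffAt ℝ ∞ s u)
    (hs' : ContDiffAt ℝ ∞ s' u) : gzExpr (s + s') t u = gzExpr s t u + gzExpr s' t u := by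
  simp only [gzExpr, hs.fderiv_fderiv_add hs',
    fderiv_add hs.differentiableAt_infty hs'.differentiableAt_infty, Pi.add_apply, map_add,
    LinearMap.add_apply]
  abel

theorem gzExpr_add_right {s t t' : Coord m → SymForm m} {u : Coord m} (ht : ContDiffAt ℝ ∞ t u)
    (ht' : ContDiffAt ℝ ∞ t' u) : gzExpr s (t + t') u = gzExpr s t u + gzExpr s t' u := by
  simp only [gzExpr, ht.fderiv_fderiv_add ht',
    fderiv_add ht.differentiableAt_infty ht'.differentiableAt_infty, Pi.add_apply, map_add,
    LinearMap.add_apply]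
  abel

theorem gzExpr_smul_left {s t : Coord m → SymForm m} {u : Coord m} (c : ℝ)
    (hs : ContDiffAt ℝ ∞ s u) : gzExpr (c • s) t u = c • gzExpr s t u := by
  simp only [gzExpr, hs.fderiv_fderiv_const_smul c,
    fderiv_const_smul hs.differentiableAt_infty, Pi.smul_apply, map_smul, LinearMap.smul_apply,
    smul_add]

theorem gzExpr_smul_right {s t : Coord m → SymForm m} {u : Coord m} (c : ℝ)
    (ht : ContDiffAt ℝ ∞ t u) : gzExpr s (c • t) u = c • gzExpr s t u := by
  simp only [gzExpr, ht.fderiv_fderiv_const_smul c,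
    fderiv_const_smul ht.differentiableAt_infty, Pi.smul_apply, map_smul, LinearMap.smul_apply,
    smul_add]

theorem gzExpr_congr {s s' t t' : Coord m → SymForm m} {u : Coord m} (hs : s =ᶠ[𝓝 u] s')
    (ht : t =ᶠ[𝓝 u] t') : gzExpr s t u = gzExpr s' t' u := by
  rw [gzExpr, gzExpr, hs.fderiv.fderiv_eq, ht.fderiv.fderiv_eq, hs.fderiv_eq, ht.fderiv_eq,
    hs.eq_of_nhds, ht.eq_of_nhds]

end Invariance

/-! ### Symplectic maps -/

section SymplecticMaps

variable {m : ℕ}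

/-- `φ` is smooth at `u` and preserves `ω` near `u`: its derivative is a symplectic matrix at all
points close to `u`. -/
def IsSymplecticAt (φ : Coord m → Coord m) (u : Coord m) : Prop :=
  ContDiffAt ℝ ∞ φ u ∧ ∀ᶠ x in 𝓝 u, ∃ A : Sp m, HasFDerivAt φ (Sp.toCLM A) x

theorem hamVec_eq_mulVec (α : Coord m →L[ℝ] ℝ) :
    hamVec m α = Matrix.J (Fin m) ℝ *ᵥ fun k => α (basisVec k) := by
  ext k
  rcases k with i | i <;>
  simp [hamVec, sharp, Matrix.J, Matrix.mulVec, dotProduct, Fintype.sum_sum_type, Matrix.one_apply,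
    Finset.sum_apply, Pi.single_apply]

/-- A symplectic matrix preserves the Poisson bivector. -/
theorem Sp.toCLM_hamVec_comp (A : Sp m) (α : Coord m →L[ℝ] ℝ) :
    Sp.toCLM A (hamVec m (α.comp (Sp.toCLM A))) = hamVec m α := by
  have h : (fun k => (α.comp (Sp.toCLM A)) (basisVec k)) =
      (A : Matrix _ _ ℝ)ᵀ *ᵥ fun k => α (basisVec k) := by
    ext k
    have h1 : A.1 *ᵥ basisVec k = ∑ i, A.1 i k • basisVec i := by
      ext j
      simp [basisVec, Finset.sum_apply, Pi.single_apply]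
    simp only [ContinuousLinearMap.comp_apply, Sp.toCLM_apply, h1, map_sum, map_smul, smul_eq_mul,
      Matrix.mulVec, dotProduct, Matrix.transpose_apply]
  rw [hamVec_eq_mulVec, hamVec_eq_mulVec, h, Sp.toCLM_apply, Matrix.mulVec_mulVec,
    Matrix.mulVec_mulVec, SymplecticGroup.mem_iff.1 A.2]

theorem poisson_comp {φ : Coord m → Coord m} {u : Coord m} {A : Sp m}
    (hφ : HasFDerivAt φ (Sp.toCLM A) u) {f g : Coord m → ℝ} (hf : DifferentiableAt ℝ f (φ u))
    (hg : DifferentiableAt ℝ g (φ u)) :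
    poisson (f ∘ φ) (g ∘ φ) u = poisson f g (φ u) := by
  rw [poisson_eq, poisson_eq, (hf.hasFDerivAt.comp u hφ).fderiv,
    (hg.hasFDerivAt.comp u hφ).fderiv, ContinuousLinearMap.comp_apply, Sp.toCLM_hamVec_comp]

theorem ContDiffAt.eventually_comp {E F G : Type*} [NormedAddCommGroup E] [NormedSpace ℝ E]
    [NormedAddCommGroup F] [NormedSpace ℝ F] [NormedAddCommGroup G] [NormedSpace ℝ G] {φ : E → F}
    {u : E} (hφ : ContDiffAt ℝ ∞ φ u) {f : F → G} (hf : ContDiffAt ℝ ∞ f (φ u)) :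
    ∀ᶠ x in 𝓝 u, DifferentiableAt ℝ f (φ x) :=
  hφ.continuousAt.eventually hf.eventually_differentiableAt

theorem IsSymplecticAt.poisson_comp {φ : Coord m → Coord m} {u : Coord m}
    (hφ : IsSymplecticAt φ u) {f g : Coord m → ℝ} (hf : ContDiffAt ℝ ∞ f (φ u))
    (hg : ContDiffAt ℝ ∞ g (φ u)) :
    poisson (f ∘ φ) (g ∘ φ) =ᶠ[𝓝 u] poisson f g ∘ φ := by
  filter_upwards [hφ.2, hφ.1.eventually_comp hf, hφ.1.eventually_comp hg] with x ⟨A, hA⟩ h1 h2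
  exact _root_.poisson_comp hA h1 h2

theorem poisson_congr {f f' g g' : Coord m → ℝ} {u : Coord m} (hf : f =ᶠ[𝓝 u] f')
    (hg : g =ᶠ[𝓝 u] g') : poisson f g =ᶠ[𝓝 u] poisson f' g' := by
  filter_upwards [hf.fderiv (𝕜 := ℝ), hg.fderiv (𝕜 := ℝ)] with x h1 h2
  rw [poisson_eq, poisson_eq, h1, h2]

/-- The pull-back of a symmetric form along a linear map. -/
def SymForm.pull (L : Coord m →L[ℝ] Coord m) (b : SymForm m) : SymForm m :=
  ⟨b.1.bilinearComp L L, fun _ _ => b.2 _ _⟩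

@[simp] theorem SymForm.pull_apply (L : Coord m →L[ℝ] Coord m) (b : SymForm m) (v w : Coord m) :
    (SymForm.pull L b).1 v w = b.1 (L v) (L w) := rfl

/-- The pull-back `φ^* s` of a field of symmetric forms. -/
def pullField (φ : Coord m → Coord m) (s : Coord m → SymForm m) (x : Coord m) : SymForm m :=
  SymForm.pull (fderiv ℝ φ x) (s (φ x))

theorem ContDiffAt.pullField {φ : Coord m → Coord m} {s : Coord m → SymForm m} {u : Coord m}
    (hφ : ContDiffAt ℝ ∞ φ u) (hs : ContDiffAt ℝ ∞ s (φ u)) :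
    ContDiffAt ℝ ∞ (pullField φ s) u := by
  refine ContDiffAt.symForm_of_apply fun v w => ?_
  have h1 : ContDiffAt ℝ ∞ (fun x => (s (φ x)).1) u :=
    (SymForm m).subtypeL.contDiff.contDiffAt.comp u (hs.comp u hφ)
  have h2 : ∀ v, ContDiffAt ℝ ∞ (fun x => fderiv ℝ φ x v) u := fun v =>
    hφ.fderiv_infty.clm_apply contDiffAt_const
  exact (h1.clm_apply (h2 v)).clm_apply (h2 w)

theorem pullField_sqDiff {φ : Coord m → Coord m} {u : Coord m} (hφ : ContDiffAt ℝ ∞ φ u)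
    {g : Coord m → ℝ} (hg : ContDiffAt ℝ ∞ g (φ u)) :
    pullField φ (sqDiff g) =ᶠ[𝓝 u] sqDiff (g ∘ φ) := by
  filter_upwards [hφ.eventually_differentiableAt, hφ.eventually_comp hg] with x h1 h2
  apply SymForm.ext_self
  intro v
  rw [sqDiff_apply, fderiv_comp x h2 h1]
  simp [pullField, sqDiff_apply]

/-- Invariance on squares: the Poisson bracket and the differential are natural. -/
theorem gzExpr_pullField_sqDiff {φ : Coord m → Coord m} {u : Coord m} (hφ : IsSymplecticAt φ u)
    {g p : Coord m → ℝ} (hg : ContDiffAt ℝ ∞ g (φ u)) (hp : ContDiffAt ℝ ∞ p (φ u)) :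
    gzExpr (pullField φ (sqDiff g)) (pullField φ (sqDiff p)) u =
      SymForm.pull (fderiv ℝ φ u) (gzExpr (sqDiff g) (sqDiff p) (φ u)) := by
  have chain : ∀ {f : Coord m → ℝ}, ContDiffAt ℝ ∞ f (φ u) → ∀ v,
      fderiv ℝ (f ∘ φ) u v = fderiv ℝ f (φ u) (fderiv ℝ φ u v) := fun hf v => by
    rw [fderiv_comp u hf.differentiableAt_infty hφ.1.differentiableAt_infty]
    rfl
  have nested : ∀ {f g : Coord m → ℝ}, ContDiffAt ℝ ∞ f (φ u) → ContDiffAt ℝ ∞ g (φ u) →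
      poisson (f ∘ φ) (poisson (f ∘ φ) (g ∘ φ)) =ᶠ[𝓝 u] poisson f (poisson f g) ∘ φ :=
    fun hf hg => (poisson_congr Filter.EventuallyEq.rfl (hφ.poisson_comp hf hg)).trans
      (hφ.poisson_comp hf (hf.poisson hg))
  rw [gzExpr_congr (pullField_sqDiff hφ.1 hg) (pullField_sqDiff hφ.1 hp)]
  apply SymForm.ext_self
  intro v
  rw [gzExpr_sqDiff (hg.comp u hφ.1) (hp.comp u hφ.1), SymForm.pull_apply, gzExpr_sqDiff hg hp,
    (hφ.poisson_comp hg hp).fderiv_eq, (nested hg hp).fderiv_eq, (nested hp hg).fderiv_eq,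
    chain hg, chain hp, chain (hg.poisson hp), chain (hg.poisson (hg.poisson hp)),
    chain (hp.poisson (hp.poisson hg))]

/-- The coordinate expression commutes with pull-back along symplectic maps. -/
theorem gzExpr_pullField {φ : Coord m → Coord m} {u : Coord m} (hφ : IsSymplecticAt φ u)
    {s t : Coord m → SymForm m} (hs : ContDiffAt ℝ ∞ s (φ u)) (ht : ContDiffAt ℝ ∞ t (φ u)) :
    gzExpr (pullField φ s) (pullField φ t) u =
      SymForm.pull (fderiv ℝ φ u) (gzExpr s t (φ u)) := by
  have pull_congr : ∀ {s s' : Coord m → SymForm m}, s =ᶠ[𝓝 (φ u)] s' →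
      pullField φ s =ᶠ[𝓝 u] pullField φ s' := fun e => by
    filter_upwards [hφ.1.continuousAt.eventually e] with x hx
    rw [pullField, pullField, hx]
  have pull_add : ∀ s s' : Coord m → SymForm m,
      pullField φ (s + s') = pullField φ s + pullField φ s' := fun _ _ => rfl
  have pull_smul : ∀ (c : ℝ) (s : Coord m → SymForm m),
      pullField φ (c • s) = c • pullField φ s := fun _ _ => rfl
  refine SymForm.field_induction (P := fun s => gzExpr (pullField φ s) (pullField φ t) u =
    SymForm.pull (fderiv ℝ φ u) (gzExpr s t (φ u))) (fun g hg => ?_) (fun s s' hs hs' h h' => ?_)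
    (fun c s hs h => ?_) (fun s s' e h => ?_) hs
  · refine SymForm.field_induction
      (P := fun t => gzExpr (pullField φ (sqDiff g)) (pullField φ t) u =
        SymForm.pull (fderiv ℝ φ u) (gzExpr (sqDiff g) t (φ u))) (fun p hp => ?_)
      (fun t t' ht ht' h h' => ?_) (fun c t ht h => ?_) (fun t t' e h => ?_) ht
    · exact gzExpr_pullField_sqDiff hφ hg hp
    · rw [pull_add, gzExpr_add_right (hφ.1.pullField ht) (hφ.1.pullField ht'), h, h',
        gzExpr_add_right ht ht']
      rfl
    · rw [pull_smul, gzExpr_smul_right c (hφ.1.pullField ht), h, gzExpr_smul_right c ht]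
      rfl
    · rw [gzExpr_congr Filter.EventuallyEq.rfl (pull_congr e.symm), h,
        gzExpr_congr Filter.EventuallyEq.rfl e]
  · rw [pull_add, gzExpr_add_left (hφ.1.pullField hs) (hφ.1.pullField hs'), h, h',
      gzExpr_add_left hs hs']
    rfl
  · rw [pull_smul, gzExpr_smul_left c (hφ.1.pullField hs), h, gzExpr_smul_left c hs]
    rfl
  · rw [gzExpr_congr (pull_congr e.symm) Filter.EventuallyEq.rfl, h,
      gzExpr_congr e Filter.EventuallyEq.rfl]

theorem Sp.toCLM_inv_apply_self (A : Sp m) (v : Coord m) :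
    Sp.toCLM A⁻¹ (Sp.toCLM A v) = v := by
  rw [← ContinuousLinearMap.comp_apply, ← Sp.toCLM_mul, inv_mul_cancel, Sp.toCLM_one]
  rfl

theorem Sp.toCLM_self_inv_apply (A : Sp m) (v : Coord m) :
    Sp.toCLM A (Sp.toCLM A⁻¹ v) = v := by
  rw [← ContinuousLinearMap.comp_apply, ← Sp.toCLM_mul, mul_inv_cancel, Sp.toCLM_one]
  rfl

theorem symFormRep_apply (A : Sp m) (b : SymForm m) (v w : Coord m) :
    (symFormRep m A b).1 v w = b.1 (Sp.toCLM A⁻¹ v) (Sp.toCLM A⁻¹ w) := rfl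

/-- The local form of invariance: if `φ` carries `s` to `s'` and `t` to `t'` near `u`, it carries
the value of the expression at `u` to its value at `φ u`. -/
theorem IsSymplecticAt.gzExpr_eq {φ : Coord m → Coord m} {u : Coord m} (hφ : IsSymplecticAt φ u)
    {s s' t t' : Coord m → SymForm m} (hs' : ContDiffAt ℝ ∞ s' (φ u))
    (ht' : ContDiffAt ℝ ∞ t' (φ u))
    (hs : ∀ᶠ x in 𝓝 u, ∀ A : Sp m, HasFDerivAt φ (Sp.toCLM A) x →
      s' (φ x) = symFormRep m A (s x))
    (ht : ∀ᶠ x in 𝓝 u, ∀ A : Sp m, HasFDerivAt φ (Sp.toCLM A) x →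
      t' (φ x) = symFormRep m A (t x))
    {A : Sp m} (hA : HasFDerivAt φ (Sp.toCLM A) u) :
    gzExpr s' t' (φ u) = symFormRep m A (gzExpr s t u) := by
  have key : ∀ {s s' : Coord m → SymForm m},
      (∀ᶠ x in 𝓝 u, ∀ A : Sp m, HasFDerivAt φ (Sp.toCLM A) x →
        s' (φ x) = symFormRep m A (s x)) → s =ᶠ[𝓝 u] pullField φ s' := fun h => by
    filter_upwards [h, hφ.2] with x hx ⟨A, hA⟩
    apply SymForm.ext_self
    intro v
    rw [pullField, SymForm.pull_apply, hx A hA, hA.fderiv, symFormRep_apply,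
      Sp.toCLM_inv_apply_self]
  rw [gzExpr_congr (key hs) (key ht), gzExpr_pullField hφ hs' ht', hA.fderiv]
  apply SymForm.ext_self
  intro v
  rw [symFormRep_apply, SymForm.pull_apply, Sp.toCLM_self_inv_apply]

end SymplecticMaps

/-! ### The operator on symplectic manifolds -/

section TensorFields

variable {m : ℕ} {V₁ V₂ W : Type*} [NormedAddCommGroup V₁] [NormedSpace ℝ V₁]
  [NormedAddCommGroup V₂] [NormedSpace ℝ V₂] [NormedAddCommGroup W] [NormedSpace ℝ W]
  {ρ₁ : Representation ℝ (Sp m) V₁} {ρ₂ : Representation ℝ (Sp m) V₂}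
  {τ : Representation ℝ (Sp m) W} {M : Type*} [TopologicalSpace M] [ChartedSpace (Coord m) M]

theorem inChart_add (s t : TensorField τ M) (e : DarbouxChart m M) :
    inChart (s + t) e = inChart s e + inChart t e := rfl

theorem inChart_smul (c : ℝ) (s : TensorField τ M) (e : DarbouxChart m M) :
    inChart (c • s) e = c • inChart s e := rfl

theorem TensorField.ext_inChart {s t : TensorField τ M}
    (h : ∀ e, ∀ u ∈ e.1.target, inChart s e u = inChart t e u) : s = t := by
  apply Subtype.ext
  funext e u
  by_cases hu : u ∈ e.1.target
  · exact h e u hu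
  · rw [s.2.2.1 e u hu, t.2.2.1 e u hu]

/-- The tensor field with given expressions in the canonical coordinate systems.  The expressions
are cut off outside the targets of the charts, as the definition of `TensorField` requires. -/
def tensorFieldOfExpr (D : DarbouxChart m M → Coord m → W)
    (smooth : ∀ e : DarbouxChart m M, ∀ u ∈ e.1.target, ContDiffAt ℝ ∞ (D e) u)
    (transition : ∀ (e e' : DarbouxChart m M), ∀ u ∈ (e.1.symm ≫ₕ e'.1).source, ∀ g : Sp m,
      HasFDerivAt (e.1.symm ≫ₕ e'.1) (Sp.toCLM g) u →
        D e' ((e.1.symm ≫ₕ e'.1) u) = τ g (D e u)) : TensorField τ M :=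
  ⟨fun e => e.1.target.indicator (D e),
    fun e => ContDiffOn.congr (f := D e) (fun u hu => (smooth e u hu).contDiffWithinAt)
      fun u hu => indicator_of_mem hu _,
    fun e u hu => indicator_of_notMem hu _,
    fun e e' u hu g hg => by
      have hu' : (e.1.symm ≫ₕ e'.1) u ∈ e'.1.target := e'.1.map_source hu.2
      have h : u ∈ e.1.target := hu.1
      simpa only [indicator_of_mem hu', indicator_of_mem h] using transition e e' u hu g hg⟩

theorem inChart_tensorFieldOfExpr (D : DarbouxChart m M → Coord m → W) (smooth) (transition)
    (e : DarbouxChart m M) {u : Coord m} (hu : u ∈ e.1.target) :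
    inChart (tensorFieldOfExpr (τ := τ) D smooth transition) e u = D e u :=
  indicator_of_mem hu _

/-- A bilinear map of tensor fields, from a map that is bilinear in all canonical coordinate
systems. -/
def tensorFieldBilinear (B : TensorField ρ₁ M → TensorField ρ₂ M → TensorField τ M)
    (add_left : ∀ s s' t e, ∀ u ∈ e.1.target,
      inChart (B (s + s') t) e u = inChart (B s t) e u + inChart (B s' t) e u)
    (smul_left : ∀ (c : ℝ) s t e, ∀ u ∈ e.1.target,
      inChart (B (c • s) t) e u = c • inChart (B s t) e u)
    (add_right : ∀ s t t' e, ∀ u ∈ e.1.target,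
      inChart (B s (t + t')) e u = inChart (B s t) e u + inChart (B s t') e u)
    (smul_right : ∀ (c : ℝ) s t e, ∀ u ∈ e.1.target,
      inChart (B s (c • t)) e u = c • inChart (B s t) e u) :
    TensorField ρ₁ M →ₗ[ℝ] TensorField ρ₂ M →ₗ[ℝ] TensorField τ M :=
  LinearMap.mk₂ ℝ B
    (fun s s' t => TensorField.ext_inChart (add_left s s' t))
    (fun c s t => TensorField.ext_inChart (smul_left c s t))
    (fun s t t' => TensorField.ext_inChart (add_right s t t'))
    (fun c s t => TensorField.ext_inChart (smul_right c s t))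

end TensorFields

section Manifold

variable {m : ℕ}

theorem IsSymplecticAt.comp {φ ψ : Coord m → Coord m} {u : Coord m} (hψ : IsSymplecticAt ψ (φ u))
    (hφ : IsSymplecticAt φ u) : IsSymplecticAt (ψ ∘ φ) u := by
  refine ⟨hψ.1.comp u hφ.1, ?_⟩
  filter_upwards [hφ.2, hφ.1.continuousAt.eventually hψ.2] with x ⟨A, hA⟩ ⟨B, hB⟩
  exact ⟨B * A, by rw [Sp.toCLM_mul]; exact hB.comp x hA⟩

theorem IsSymplecticAt.congr {φ ψ : Coord m → Coord m} {u : Coord m} (hφ : IsSymplecticAt φ u)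
    (h : ψ =ᶠ[𝓝 u] φ) : IsSymplecticAt ψ u := by
  refine ⟨hφ.1.congr_of_eventuallyEq h, ?_⟩
  filter_upwards [hφ.2, h.eventuallyEq_nhds] with x ⟨A, hA⟩ hx
  exact ⟨A, hA.congr_of_eventuallyEq hx⟩

theorem isSymplecticAt_of_mem_groupoid {φ : OpenPartialHomeomorph (Coord m) (Coord m)}
    (h : φ ∈ symplecticGroupoid m) {u : Coord m} (hu : u ∈ φ.source) : IsSymplecticAt φ u := by
  obtain ⟨h1, h2⟩ := (mem_groupoid_of_pregroupoid.1 h).1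
  exact ⟨h1.contDiffAt (φ.open_source.mem_nhds hu),
    Filter.eventually_of_mem (φ.open_source.mem_nhds hu) h2⟩

theorem ContDiffAt.gzExpr {s t : Coord m → SymForm m} {u : Coord m} (hs : ContDiffAt ℝ ∞ s u)
    (ht : ContDiffAt ℝ ∞ t u) : ContDiffAt ℝ ∞ (gzExpr s t) u := by
  have h2 : ∀ {s t : Coord m → SymForm m}, ContDiffAt ℝ ∞ s u → ContDiffAt ℝ ∞ t u →
      ContDiffAt ℝ ∞ (fun x => symbolTwoₗ m (fderiv ℝ (fderiv ℝ s) x) (t x)) u := fun hs ht =>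
    ((symbolTwoₗ m).toContinuousBilinearMap.contDiff.contDiffAt.comp u
      hs.fderiv_infty.fderiv_infty).clm_apply ht
  have h1 : ContDiffAt ℝ ∞ (fun x => symbolOneₗ m (fderiv ℝ s x) (fderiv ℝ t x)) u :=
    ((symbolOneₗ m).toContinuousBilinearMap.contDiff.contDiffAt.comp u
      hs.fderiv_infty).clm_apply ht.fderiv_infty
  exact ((h2 hs ht).add h1).add (h2 ht hs)

variable {M N : Type*} [TopologicalSpace M] [ChartedSpace (Coord m) M] [TopologicalSpace N]
  [ChartedSpace (Coord m) N]

theorem inChart_contDiffAt (s : SymTwoForms m M) (e : DarbouxChart m M) {u : Coord m}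
    (hu : u ∈ e.1.target) : ContDiffAt ℝ ∞ (inChart s e) u :=
  (s.2.1 e).contDiffAt (e.1.open_target.mem_nhds hu)

theorem inChart_transition [IsSymplecticManifold m M] (s : SymTwoForms m M)
    (e e' : DarbouxChart m M) {u : Coord m} (hu : u ∈ (e.1.symm ≫ₕ e'.1).source) :
    ∀ᶠ x in 𝓝 u, ∀ A : Sp m, HasFDerivAt (e.1.symm ≫ₕ e'.1) (Sp.toCLM A) x →
      inChart s e' ((e.1.symm ≫ₕ e'.1) x) = symFormRep m A (inChart s e x) :=
  Filter.eventually_of_mem ((e.1.symm ≫ₕ e'.1).open_source.mem_nhds hu)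
    fun x hx A hA => s.2.2.2 e e' x hx A hA

/-- The product of two symmetric 2-forms: the symmetric form with expression `gzExpr` in every
canonical coordinate system. -/
def gzField [IsSymplecticManifold m M] (s t : SymTwoForms m M) : SymTwoForms m M :=
  tensorFieldOfExpr (fun e => gzExpr (inChart s e) (inChart t e))
    (fun e _ hu => (inChart_contDiffAt s e hu).gzExpr (inChart_contDiffAt t e hu))
    (fun e e' u hu A hA => by
      have hu' : (e.1.symm ≫ₕ e'.1) u ∈ e'.1.target := e'.1.map_source hu.2
      exact (isSymplecticAt_of_mem_groupoid
        (StructureGroupoid.compatible_of_mem_maximalAtlas e.2 e'.2) hu).gzExpr_eq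
        (inChart_contDiffAt s e' hu') (inChart_contDiffAt t e' hu')
        (inChart_transition s e e' hu) (inChart_transition t e e' hu) hA)

theorem inChart_gzField [IsSymplecticManifold m M] (s t : SymTwoForms m M) (e : DarbouxChart m M)
    {u : Coord m} (hu : u ∈ e.1.target) :
    inChart (gzField s t) e u = gzExpr (inChart s e) (inChart t e) u :=
  inChart_tensorFieldOfExpr _ _ _ e hu

/-- The operator `Gz` on a symplectic manifold. -/
def gzOperator (m : ℕ) (M : Type*) [TopologicalSpace M] [ChartedSpace (Coord m) M]
    [IsSymplecticManifold m M] : SymTwoForms m M →ₗ[ℝ] SymTwoForms m M →ₗ[ℝ] SymTwoForms m M :=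
  tensorFieldBilinear gzField
    (fun s s' t e u hu => by
      rw [inChart_gzField _ _ _ hu, inChart_gzField _ _ _ hu, inChart_gzField _ _ _ hu,
        inChart_add]
      exact gzExpr_add_left (inChart_contDiffAt s e hu) (inChart_contDiffAt s' e hu))
    (fun c s t e u hu => by
      rw [inChart_gzField _ _ _ hu, inChart_gzField _ _ _ hu, inChart_smul]
      exact gzExpr_smul_left c (inChart_contDiffAt s e hu))
    (fun s t t' e u hu => by
      rw [inChart_gzField _ _ _ hu, inChart_gzField _ _ _ hu, inChart_gzField _ _ _ hu,
        inChart_add]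
      exact gzExpr_add_right (inChart_contDiffAt t e hu) (inChart_contDiffAt t' e hu))
    (fun c s t e u hu => by
      rw [inChart_gzField _ _ _ hu, inChart_gzField _ _ _ hu, inChart_smul]
      exact gzExpr_smul_right c (inChart_contDiffAt t e hu))

theorem inChart_gzOperator [IsSymplecticManifold m M] (s t : SymTwoForms m M)
    (e : DarbouxChart m M) {u : Coord m} (hu : u ∈ e.1.target) :
    inChart (gzOperator m M s t) e u = gzExpr (inChart s e) (inChart t e) u :=
  inChart_gzField s t e hu

/-- In arbitrary canonical coordinates a symplectomorphism is symplectic; `Structomorph` says so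
for the charts of the given atlases only. -/
theorem isSymplecticAt_structomorph [IsSymplecticManifold m M] [IsSymplecticManifold m N]
    (f : Structomorph (symplecticGroupoid m) M N) (e : DarbouxChart m M) (e' : DarbouxChart m N)
    {u : Coord m}
    (hu : u ∈ (e.1.symm ≫ₕ f.toHomeomorph.toOpenPartialHomeomorph ≫ₕ e'.1).source) :
    IsSymplecticAt (e.1.symm ≫ₕ f.toHomeomorph.toOpenPartialHomeomorph ≫ₕ e'.1) u := by
  obtain ⟨hu1, -, hu2⟩ := hu
  let c := chartAt (Coord m) (e.1.symm u)
  let c' := chartAt (Coord m) (f.toHomeomorph (e.1.symm u))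
  have hc : e.1.symm u ∈ c.source := mem_chart_source _ _
  have hc' : f.toHomeomorph (e.1.symm u) ∈ c'.source := mem_chart_source _ _
  have k1 : c.symm (c (e.1.symm u)) = e.1.symm u := c.left_inv hc
  have k2 : c'.symm (c' (f.toHomeomorph (e.1.symm u))) = f.toHomeomorph (e.1.symm u) :=
    c'.left_inv hc'
  have h1 : IsSymplecticAt (e.1.symm ≫ₕ c) u :=
    isSymplecticAt_of_mem_groupoid (StructureGroupoid.compatible_of_mem_maximalAtlas e.2
      (StructureGroupoid.chart_mem_maximalAtlas _ _)) ⟨hu1, hc⟩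
  have h2 : IsSymplecticAt (c.symm ≫ₕ f.toHomeomorph.toOpenPartialHomeomorph ≫ₕ c')
      (c (e.1.symm u)) := by
    refine isSymplecticAt_of_mem_groupoid (f.mem_groupoid c c' (chart_mem_atlas _ _)
      (chart_mem_atlas _ _)) ⟨c.map_source hc, mem_univ _, ?_⟩
    change f.toHomeomorph (c.symm (c (e.1.symm u))) ∈ c'.source
    rwa [k1]
  have h3 : IsSymplecticAt (c'.symm ≫ₕ e'.1) (c' (f.toHomeomorph (e.1.symm u))) := by
    refine isSymplecticAt_of_mem_groupoid (StructureGroupoid.compatible_of_mem_maximalAtlas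
      (StructureGroupoid.chart_mem_maximalAtlas _ _) e'.2) ⟨c'.map_source hc', ?_⟩
    change c'.symm (c' (f.toHomeomorph (e.1.symm u))) ∈ e'.1.source
    rw [k2]
    exact hu2
  have h23 : IsSymplecticAt ((c'.symm ≫ₕ e'.1) ∘
      (c.symm ≫ₕ f.toHomeomorph.toOpenPartialHomeomorph ≫ₕ c')) (c (e.1.symm u)) := by
    refine IsSymplecticAt.comp ?_ h2
    change IsSymplecticAt _ (c' (f.toHomeomorph (c.symm (c (e.1.symm u)))))
    rwa [k1]
  refine (IsSymplecticAt.comp (φ := e.1.symm ≫ₕ c) h23 h1).congr ?_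
  have n1 : ∀ᶠ x in 𝓝 u, e.1.symm x ∈ c.source :=
    (e.1.symm.continuousAt hu1).eventually (c.open_source.mem_nhds hc)
  have n2 : ∀ᶠ x in 𝓝 u, f.toHomeomorph (e.1.symm x) ∈ c'.source :=
    (f.toHomeomorph.continuous.continuousAt.comp (e.1.symm.continuousAt hu1)).eventually
      (c'.open_source.mem_nhds hc')
  filter_upwards [n1, n2] with x hx1 hx2
  change e'.1 (f.toHomeomorph (e.1.symm x)) =
    e'.1 (c'.symm (c' (f.toHomeomorph (c.symm (c (e.1.symm x))))))
  rw [c.left_inv hx1, c'.left_inv hx2]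

theorem commutesWithSymplectomorphisms_gzOperator (m : ℕ) :
    CommutesWithSymplectomorphisms (fun (M : Type u) => gzOperator m M) := by
  intro M N _ _ _ _ _ _ f s s' t t' hs ht e e' u hu A hA
  have hu' : (e.1.symm ≫ₕ f.toHomeomorph.toOpenPartialHomeomorph ≫ₕ e'.1) u ∈ e'.1.target :=
    e'.1.map_source hu.2.2
  have hn := (e.1.symm ≫ₕ f.toHomeomorph.toOpenPartialHomeomorph ≫ₕ e'.1).open_source.mem_nhds hu
  rw [inChart_gzOperator _ _ _ hu', inChart_gzOperator _ _ _ hu.1]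
  exact (isSymplecticAt_structomorph f e e' hu).gzExpr_eq (inChart_contDiffAt s' e' hu')
    (inChart_contDiffAt t' e' hu') (Filter.eventually_of_mem hn fun x hx => hs e e' x hx)
    (Filter.eventually_of_mem hn fun x hx => ht e e' x hx) hA

end Manifold

/-! ### The order of the operator -/

section Order

variable {m : ℕ} {V₁ V₂ W : Type*} [NormedAddCommGroup V₁] [NormedSpace ℝ V₁]
  [NormedAddCommGroup V₂] [NormedSpace ℝ V₂] [NormedAddCommGroup W] [NormedSpace ℝ W]

/-- Second derivatives as iterated linear maps. -/
def curryTwo (E V : Type*) [NormedAddCommGroup E] [NormedSpace ℝ E] [NormedAddCommGroup V]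
    [NormedSpace ℝ V] : (E [×2]→L[ℝ] V) →L[ℝ] E →L[ℝ] E →L[ℝ] V :=
  (ContinuousLinearMap.compL ℝ E (E [×1]→L[ℝ] V) (E →L[ℝ] V)
    ((continuousMultilinearCurryFin1 ℝ E V).toContinuousLinearEquiv :
      (E [×1]→L[ℝ] V) →L[ℝ] E →L[ℝ] V)).comp
    ((continuousMultilinearCurryLeftEquiv ℝ (fun _ : Fin 2 => E) V).toContinuousLinearEquiv :
      (E [×2]→L[ℝ] V) →L[ℝ] E →L[ℝ] (E [×1]→L[ℝ] V))

theorem curryTwo_iteratedFDeriv {E V : Type*} [NormedAddCommGroup E] [NormedSpace ℝ E]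
    [NormedAddCommGroup V] [NormedSpace ℝ V] (s : E → V) (u : E) :
    curryTwo E V (iteratedFDeriv ℝ 2 s u) = fderiv ℝ (fderiv ℝ s) u := by
  ext x y
  have : curryTwo E V (iteratedFDeriv ℝ 2 s u) x y = iteratedFDeriv ℝ 2 s u ![x, y] := by
    simp [curryTwo]
  rw [this, iteratedFDeriv_two_apply]
  rfl

theorem continuousMultilinearCurryFin1_iteratedFDeriv {E V : Type*} [NormedAddCommGroup E]
    [NormedSpace ℝ E] [NormedAddCommGroup V] [NormedSpace ℝ V] (s : E → V) (u : E) :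
    continuousMultilinearCurryFin1 ℝ E V (iteratedFDeriv ℝ 1 s u) = fderiv ℝ s u := by
  ext x
  simp

/-- Bilinear maps of the iterated Fréchet derivatives, of total order two and with constant
coefficients, define a bilinear differential operator of order at most two. -/
theorem isBilinearDiffOp_two (A : (Coord m →L[ℝ] Coord m →L[ℝ] V₁) →L[ℝ] V₂ →L[ℝ] W)
    (B : (Coord m →L[ℝ] V₁) →L[ℝ] (Coord m →L[ℝ] V₂) →L[ℝ] W)
    (C : V₁ →L[ℝ] (Coord m →L[ℝ] Coord m →L[ℝ] V₂) →L[ℝ] W) :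
    IsBilinearDiffOp 2 fun s t u =>
      A (fderiv ℝ (fderiv ℝ s) u) (t u) + B (fderiv ℝ s u) (fderiv ℝ t u) +
        C (s u) (fderiv ℝ (fderiv ℝ t) u) := by
  let c : (i j : ℕ) → ((Coord m [×i]→L[ℝ] V₁) →L[ℝ] (Coord m [×j]→L[ℝ] V₂) →L[ℝ] W) := fun i j =>
    match i, j with
    | 2, 0 => A.bilinearComp (curryTwo (Coord m) V₁)
        ((continuousMultilinearCurryFin0 ℝ (Coord m) V₂).toContinuousLinearEquiv :
          (Coord m [×0]→L[ℝ] V₂) →L[ℝ] V₂)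
    | 1, 1 => B.bilinearComp
        ((continuousMultilinearCurryFin1 ℝ (Coord m) V₁).toContinuousLinearEquiv :
          (Coord m [×1]→L[ℝ] V₁) →L[ℝ] Coord m →L[ℝ] V₁)
        ((continuousMultilinearCurryFin1 ℝ (Coord m) V₂).toContinuousLinearEquiv :
          (Coord m [×1]→L[ℝ] V₂) →L[ℝ] Coord m →L[ℝ] V₂)
    | 0, 2 => C.bilinearComp
        ((continuousMultilinearCurryFin0 ℝ (Coord m) V₁).toContinuousLinearEquiv :
          (Coord m [×0]→L[ℝ] V₁) →L[ℝ] V₁) (curryTwo (Coord m) V₂)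
    | _, _ => 0
  refine ⟨fun i j _ => c i j, fun _ _ => contDiff_const, fun s t u _ _ => ?_⟩
  have h1 : c 2 0 (iteratedFDeriv ℝ 2 s u) (iteratedFDeriv ℝ 0 t u) =
      A (fderiv ℝ (fderiv ℝ s) u) (t u) := by
    rw [← curryTwo_iteratedFDeriv s]
    rfl
  have h2 : c 1 1 (iteratedFDeriv ℝ 1 s u) (iteratedFDeriv ℝ 1 t u) =
      B (fderiv ℝ s u) (fderiv ℝ t u) := by
    rw [← continuousMultilinearCurryFin1_iteratedFDeriv s,
      ← continuousMultilinearCurryFin1_iteratedFDeriv t]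
    rfl
  have h3 : c 0 2 (iteratedFDeriv ℝ 0 s u) (iteratedFDeriv ℝ 2 t u) =
      C (s u) (fderiv ℝ (fderiv ℝ t) u) := by
    rw [← curryTwo_iteratedFDeriv t]
    rfl
  have h4 : c 0 0 (iteratedFDeriv ℝ 0 s u) (iteratedFDeriv ℝ 0 t u) = 0 := rfl
  have h5 : c 0 1 (iteratedFDeriv ℝ 0 s u) (iteratedFDeriv ℝ 1 t u) = 0 := rfl
  have h6 : c 1 0 (iteratedFDeriv ℝ 1 s u) (iteratedFDeriv ℝ 0 t u) = 0 := rfl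
  simp only [Finset.sum_range_succ, Finset.range_zero, Finset.sum_empty,
    Finset.Nat.sum_antidiagonal_succ, Finset.Nat.antidiagonal_zero, Finset.sum_singleton]
  rw [h1, h2, h3, h4, h5, h6]
  abel

/-- An operator of order at most one depends on its first argument through the `1`-jet only. -/
theorem IsBilinearDiffOp.eq_zero_of_jet_eq_zero
    {D : (Coord m → V₁) → (Coord m → V₂) → Coord m → W} (hD : IsBilinearDiffOp 1 D)
    {s : Coord m → V₁} {t : Coord m → V₂} {u : Coord m} (hs : ContDiffAt ℝ ∞ s u)
    (ht : ContDiffAt ℝ ∞ t u) (h0 : s u = 0) (h1 : fderiv ℝ s u = 0) : D s t u = 0 := by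
  obtain ⟨c, -, hc⟩ := hD
  have e0 : iteratedFDeriv ℝ 0 s u = 0 := by
    ext x
    simp [h0]
  have e1 : iteratedFDeriv ℝ 1 s u = 0 := by
    ext x
    simp [h1]
  rw [hc s t u hs ht]
  simp only [Finset.sum_range_succ, Finset.range_zero, Finset.sum_empty,
    Finset.Nat.sum_antidiagonal_succ, Finset.Nat.antidiagonal_zero, Finset.sum_singleton, e0,
    e1, map_zero, zero_apply, add_zero]

end Order

section GzOrder

variable {m : ℕ}

theorem isBilinearDiffOp_gzExpr : IsBilinearDiffOp 2 (gzExpr (m := m)) :=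
  isBilinearDiffOp_two (symbolTwoₗ m).toContinuousBilinearMap (symbolOneₗ m).toContinuousBilinearMap
    (symbolTwoₗ m).toContinuousBilinearMap.flip

theorem hamVec_apply_inl (α : Coord m →L[ℝ] ℝ) (i : Fin m) :
    hamVec m α (Sum.inl i) = -α (basisVec (Sum.inr i)) := by
  simp [hamVec, sharp, Fintype.sum_sum_type, Finset.sum_apply, Pi.single_apply]

theorem hamVec_apply_inr (α : Coord m →L[ℝ] ℝ) (i : Fin m) :
    hamVec m α (Sum.inr i) = α (basisVec (Sum.inl i)) := by
  simp [hamVec, sharp, Fintype.sum_sum_type, Finset.sum_apply, Pi.single_apply]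

/-- The form `x₁² dx₁²` has zero `1`-jet at the origin, but its product with `dy₁²` is `2 dx₁²`
there. -/
theorem not_isBilinearDiffOp_one_gzExpr (hm : 1 ≤ m) : ¬ IsBilinearDiffOp 1 (gzExpr (m := m)) := by
  intro hD
  let i : Fin m := ⟨0, hm⟩
  let g : Coord m → ℝ := fun x => 1 / 2 * (x (Sum.inl i) * x (Sum.inl i))
  let p : Coord m → ℝ := fun x => x (Sum.inr i)
  have hproj : ∀ k x, fderiv ℝ (fun y : Coord m => y k) x = ContinuousLinearMap.proj k :=
    fun k x => (ContinuousLinearMap.proj (R := ℝ) (φ := fun _ : Fin m ⊕ Fin m => ℝ) k).fderiv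
  have hx : ∀ k, ContDiff ℝ ∞ (fun y : Coord m => y k) := fun k => contDiff_apply ℝ ℝ k
  have hg : ContDiff ℝ ∞ g := contDiff_const.mul ((hx _).mul (hx _))
  have hp : ContDiff ℝ ∞ p := hx _
  have hdx : ∀ k x, DifferentiableAt ℝ (fun y : Coord m => y k) x :=
    fun k x => (hx k).contDiffAt.differentiableAt_infty
  have dg : ∀ x, fderiv ℝ g x = x (Sum.inl i) • ContinuousLinearMap.proj (Sum.inl i) := fun x => by
    ext v
    change fderiv ℝ (fun x : Coord m => 1 / 2 * (x (Sum.inl i) * x (Sum.inl i))) x v = _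
    rw [fderiv_const_mul ((hdx _ x).fun_mul (hdx _ x)), smul_apply,
      fderiv_mul_apply (hdx _ x) (hdx _ x), hproj]
    simp
    ring
  have dp : ∀ x, fderiv ℝ p x = ContinuousLinearMap.proj (Sum.inr i) := hproj _
  have hgp : poisson g p = fun x => x (Sum.inl i) := by
    ext x
    rw [poisson_eq, dp, ContinuousLinearMap.proj_apply, hamVec_apply_inr, dg]
    simp
  have hggp : poisson g (poisson g p) = fun _ => 0 := by
    ext x
    rw [hgp, poisson_eq, hproj, ContinuousLinearMap.proj_apply, hamVec_apply_inl, dg]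
    simp
  have dg0 : fderiv ℝ g 0 = 0 := by simp [dg]
  -- `dg` vanishes at the origin, and so does the `1`-jet of its square.
  have h0 : gzExpr (sqDiff g) (sqDiff p) 0 = 0 := by
    refine hD.eq_zero_of_jet_eq_zero hg.contDiffAt.sqDiff hp.contDiffAt.sqDiff ?_ ?_
    · apply SymForm.ext_self
      intro v
      simp [sqDiff_apply, dg0]
    · ext1 z
      apply SymForm.ext_self
      intro v
      rw [fderiv_sqDiff_apply hg.contDiffAt.fderiv_infty.differentiableAt_infty, dg0]
      simp
  have h2 := gzExpr_sqDiff (u := 0) hg.contDiffAt hp.contDiffAt (basisVec (Sum.inl i))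
  rw [h0, hggp, hgp, hproj, dg0] at h2
  simp at h2

end GzOrder

/-! ### The plane -/

section Plane

theorem fderiv_fderiv_mul {E : Type*} [NormedAddCommGroup E] [NormedSpace ℝ E] {a b : E → ℝ}
    {u : E} (ha : ContDiffAt ℝ ∞ a u) (hb : ContDiffAt ℝ ∞ b u) (y z : E) :
    fderiv ℝ (fun x => fderiv ℝ (fun w => a w * b w) x z) u y =
      fderiv ℝ (fun x => fderiv ℝ a x z) u y * b u + fderiv ℝ a u z * fderiv ℝ b u y +
        fderiv ℝ a u y * fderiv ℝ b u z + a u * fderiv ℝ (fun x => fderiv ℝ b x z) u y := by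
  have da : DifferentiableAt ℝ (fun x => fderiv ℝ a x z) u :=
    ha.fderiv_infty.differentiableAt_infty.clm_apply (differentiableAt_const z)
  have db : DifferentiableAt ℝ (fun x => fderiv ℝ b x z) u :=
    hb.fderiv_infty.differentiableAt_infty.clm_apply (differentiableAt_const z)
  have e : (fun x => fderiv ℝ (fun w => a w * b w) x z) =ᶠ[𝓝 u]
      fun x => fderiv ℝ a x z * b x + a x * fderiv ℝ b x z := by
    filter_upwards [ha.eventually_differentiableAt, hb.eventually_differentiableAt] with x h1 h2
    exact fderiv_mul_apply h1 h2 z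
  rw [e.fderiv_eq, fderiv_fun_add (da.fun_mul hb.differentiableAt_infty)
    (ha.differentiableAt_infty.fun_mul db), add_apply,
    fderiv_mul_apply da hb.differentiableAt_infty,
    fderiv_mul_apply ha.differentiableAt_infty db]
  ring

end Plane

section PlaneFormula

theorem sharp_ix : sharp ix = basisVec iy := rfl

theorem sharp_iy : sharp iy = -basisVec ix := rfl

theorem sum_ix_iy (f : Fin 1 ⊕ Fin 1 → ℝ) : ∑ k, f k = f ix + f iy := by
  simp [Fintype.sum_sum_type, ix, iy]

/-- The vector of the plane with coordinates `p`, `q`. -/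
def planeVec (p q : ℝ) : Coord 1 := p • basisVec ix + q • basisVec iy

theorem SymForm.apply_planeVec_left (b : SymForm 1) (p q : ℝ) (w : Coord 1) :
    b.1 (planeVec p q) w = p * b.1 (basisVec ix) w + q * b.1 (basisVec iy) w := by
  simp [planeVec]

theorem SymForm.apply_planeVec_right (b : SymForm 1) (p q : ℝ) (w : Coord 1) :
    b.1 w (planeVec p q) = p * b.1 w (basisVec ix) + q * b.1 w (basisVec iy) := by
  simp [planeVec]

theorem SymForm.apply_iy_ix (b : SymForm 1) :
    b.1 (basisVec iy) (basisVec ix) = b.1 (basisVec ix) (basisVec iy) := b.2 _ _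

theorem SymForm.neg_apply (b : SymForm 1) (v w : Coord 1) : (-b).1 v w = -b.1 v w := rfl

theorem SymForm.apply_neg_left (b : SymForm 1) (v w : Coord 1) : b.1 (-v) w = -b.1 v w := by simp

theorem SymForm.apply_neg_right (b : SymForm 1) (v w : Coord 1) : b.1 v (-w) = -b.1 v w := by simp

/-- The expansion of `symbolTwo` in the plane, with the derivative indices of `S` listed first. -/
theorem symbolTwo_plane (S : Coord 1 →L[ℝ] Coord 1 →L[ℝ] SymForm 1) (τ : SymForm 1)
    (hS : S (basisVec iy) (basisVec ix) = S (basisVec ix) (basisVec iy)) (p q : ℝ) :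
    (symbolTwo S τ).1 (planeVec p q) (planeVec p q) =
      τ.1 (basisVec ix) (basisVec ix) *
          (S (basisVec iy) (basisVec iy)).1 (planeVec p q) (planeVec p q) -
        2 * (τ.1 (basisVec ix) (basisVec iy) *
          (S (basisVec ix) (basisVec iy)).1 (planeVec p q) (planeVec p q)) +
        τ.1 (basisVec iy) (basisVec iy) *
          (S (basisVec ix) (basisVec ix)).1 (planeVec p q) (planeVec p q) +
        2 * ((p * (S (basisVec ix) (basisVec iy)).1 (basisVec ix) (basisVec ix) +
            q * (S (basisVec iy) (basisVec iy)).1 (basisVec ix) (basisVec ix) -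
            p * (S (basisVec ix) (basisVec ix)).1 (basisVec ix) (basisVec iy) -
            q * (S (basisVec ix) (basisVec iy)).1 (basisVec ix) (basisVec iy)) *
              τ.1 (basisVec iy) (planeVec p q) -
          (p * (S (basisVec ix) (basisVec iy)).1 (basisVec ix) (basisVec iy) +
            q * (S (basisVec iy) (basisVec iy)).1 (basisVec ix) (basisVec iy) -
            p * (S (basisVec ix) (basisVec ix)).1 (basisVec iy) (basisVec iy) -
            q * (S (basisVec ix) (basisVec iy)).1 (basisVec iy) (basisVec iy)) *
              τ.1 (basisVec ix) (planeVec p q)) := by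
  have hv : ∀ w, S (planeVec p q) w = p • S (basisVec ix) w + q • S (basisVec iy) w := fun w => by
    simp [planeVec]
  have hn : ∀ v w, S v (-w) = -S v w := fun v w => map_neg _ _
  have hn' : ∀ v w, S (-v) w = -S v w := fun v w => by rw [map_neg]; rfl
  have ha : ∀ (b c : SymForm 1) v w, (p • b + q • c).1 v w = p * b.1 v w + q * c.1 v w :=
    fun _ _ _ _ => rfl
  rw [symbolTwo_apply_self]
  simp only [sum_ix_iy, sharp_ix, sharp_iy, hv, hn, hn', ha, hS, SymForm.neg_apply,
    SymForm.apply_neg_left, SymForm.apply_iy_ix]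
  ring

/-- The expansion of `symbolOne` in the plane.  Here the contractions that do not appear in the
explicit formula cancel or combine, which is special to dimension two. -/
theorem symbolOne_plane (S T : Coord 1 →L[ℝ] SymForm 1) (p q : ℝ) (A B C D : SymForm 1)
    (hA : S (basisVec ix) = A) (hB : S (basisVec iy) = B) (hC : T (basisVec ix) = C)
    (hD : T (basisVec iy) = D) :
    (symbolOne S T).1 (planeVec p q) (planeVec p q) =
      2 * (A.1 (basisVec ix) (basisVec ix) * C.1 (basisVec iy) (basisVec iy) -
          2 * (A.1 (basisVec ix) (basisVec iy) * C.1 (basisVec ix) (basisVec iy)) +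
          A.1 (basisVec iy) (basisVec iy) * C.1 (basisVec ix) (basisVec ix)) * p ^ 2 +
        2 * (A.1 (basisVec ix) (basisVec ix) * D.1 (basisVec iy) (basisVec iy) +
          B.1 (basisVec ix) (basisVec ix) * C.1 (basisVec iy) (basisVec iy) -
          2 * (A.1 (basisVec ix) (basisVec iy) * D.1 (basisVec ix) (basisVec iy) +
            B.1 (basisVec ix) (basisVec iy) * C.1 (basisVec ix) (basisVec iy)) +
          A.1 (basisVec iy) (basisVec iy) * D.1 (basisVec ix) (basisVec ix) +
          B.1 (basisVec iy) (basisVec iy) * C.1 (basisVec ix) (basisVec ix)) * (p * q) +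
        2 * (B.1 (basisVec ix) (basisVec ix) * D.1 (basisVec iy) (basisVec iy) -
          2 * (B.1 (basisVec ix) (basisVec iy) * D.1 (basisVec ix) (basisVec iy)) +
          B.1 (basisVec iy) (basisVec iy) * D.1 (basisVec ix) (basisVec ix)) * q ^ 2 +
        (A.1 (basisVec ix) (basisVec ix) * D.1 (basisVec ix) (basisVec iy) -
          B.1 (basisVec ix) (basisVec ix) * C.1 (basisVec ix) (basisVec iy) -
          (A.1 (basisVec ix) (basisVec iy) * D.1 (basisVec ix) (basisVec ix) -
          B.1 (basisVec ix) (basisVec iy) * C.1 (basisVec ix) (basisVec ix))) * p ^ 2 +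
        (A.1 (basisVec ix) (basisVec ix) * D.1 (basisVec iy) (basisVec iy) -
          B.1 (basisVec ix) (basisVec ix) * C.1 (basisVec iy) (basisVec iy) -
          (A.1 (basisVec iy) (basisVec iy) * D.1 (basisVec ix) (basisVec ix) -
          B.1 (basisVec iy) (basisVec iy) * C.1 (basisVec ix) (basisVec ix))) * (p * q) +
        (A.1 (basisVec ix) (basisVec iy) * D.1 (basisVec iy) (basisVec iy) -
          B.1 (basisVec ix) (basisVec iy) * C.1 (basisVec iy) (basisVec iy) -
          (A.1 (basisVec iy) (basisVec iy) * D.1 (basisVec ix) (basisVec iy) -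
          B.1 (basisVec iy) (basisVec iy) * C.1 (basisVec ix) (basisVec iy))) * q ^ 2 := by
  have hS : S (planeVec p q) = p • A + q • B := by simp [planeVec, hA, hB]
  have hT : T (planeVec p q) = p • C + q • D := by simp [planeVec, hC, hD]
  have nS : ∀ v, S (-v) = -S v := fun v => map_neg _ _
  have nT : ∀ v, T (-v) = -T v := fun v => map_neg _ _
  have ha : ∀ (b c : SymForm 1) v w, (p • b + q • c).1 v w = p * b.1 v w + q * c.1 v w :=
    fun _ _ _ _ => rfl
  rw [symbolOne_apply_self]
  simp only [sum_ix_iy, sharp_ix, sharp_iy, hS, hT, nS, nT, hA, hB, hC, hD, ha, SymForm.neg_apply,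
    SymForm.apply_neg_left, SymForm.apply_neg_right, SymForm.apply_planeVec_right,
    SymForm.apply_planeVec_left, SymForm.apply_iy_ix]
  ring

theorem partialDeriv_partialDeriv_combination {a b c a' b' c' : Coord 1 → ℝ} {u : Coord 1}
    (ha : ContDiffAt ℝ ∞ a u) (hb : ContDiffAt ℝ ∞ b u) (hc : ContDiffAt ℝ ∞ c u)
    (ha' : ContDiffAt ℝ ∞ a' u) (hb' : ContDiffAt ℝ ∞ b' u) (hc' : ContDiffAt ℝ ∞ c' u)
    (i j : Fin 1 ⊕ Fin 1) :
    partialDeriv i (partialDeriv j fun z => a z * c' z - 2 * (b z * b' z) + c z * a' z) u =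
      partialDeriv i (partialDeriv j fun z => a z * c' z) u -
        2 * partialDeriv i (partialDeriv j fun z => b z * b' z) u +
        partialDeriv i (partialDeriv j fun z => c z * a' z) u := by
  have h1 := ha.mul hc'
  have h2 := hb.mul hb'
  have h3 := hc.mul ha'
  have d : ∀ {f : Coord 1 → ℝ}, ContDiffAt ℝ ∞ f u → DifferentiableAt ℝ (partialDeriv j f) u :=
    fun hf => hf.fderiv_infty.differentiableAt_infty.clm_apply (differentiableAt_const _)
  have e : (partialDeriv j fun z => a z * c' z - 2 * (b z * b' z) + c z * a' z) =ᶠ[𝓝 u]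
      fun x => (partialDeriv j fun z => a z * c' z) x -
        2 * (partialDeriv j fun z => b z * b' z) x + (partialDeriv j fun z => c z * a' z) x := by
    filter_upwards [h1.eventually_differentiableAt, h2.eventually_differentiableAt,
      h3.eventually_differentiableAt] with x k1 k2 k3
    simp only [partialDeriv]
    rw [fderiv_fun_add (k1.fun_sub (k2.const_mul 2)) k3, fderiv_fun_sub k1 (k2.const_mul 2),
      fderiv_const_mul k2]
    simp
  rw [partialDeriv, e.fderiv_eq, fderiv_fun_add ((d h1).fun_sub ((d h2).const_mul 2)) (d h3),
    fderiv_fun_sub (d h1) ((d h2).const_mul 2), fderiv_const_mul (d h2)]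
  rfl

/-- The value at `u` of `∂ᵢ∂ⱼ(f g)`, by the Leibniz rule. -/
def leibnizTwo (i j : Fin 1 ⊕ Fin 1) (f g : Coord 1 → ℝ) (u : Coord 1) : ℝ :=
  partialDeriv i (partialDeriv j f) u * g u + partialDeriv j f u * partialDeriv i g u +
    partialDeriv i f u * partialDeriv j g u + f u * partialDeriv i (partialDeriv j g) u

theorem planeGz_eq {a b c a' b' c' : Coord 1 → ℝ} {u : Coord 1}
    (ha : ContDiffAt ℝ ∞ a u) (hb : ContDiffAt ℝ ∞ b u) (hc : ContDiffAt ℝ ∞ c u)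
    (ha' : ContDiffAt ℝ ∞ a' u) (hb' : ContDiffAt ℝ ∞ b' u) (hc' : ContDiffAt ℝ ∞ c' u)
    (v : Coord 1) :
    planeGz a b c a' b' c' u v =
      (leibnizTwo ix ix a c' u - 2 * leibnizTwo ix ix b b' u + leibnizTwo ix ix c a' u) *
          v ix ^ 2 +
      2 * (leibnizTwo ix iy a c' u - 2 * leibnizTwo ix iy b b' u + leibnizTwo ix iy c a' u) *
          (v ix * v iy) +
      (leibnizTwo iy iy a c' u - 2 * leibnizTwo iy iy b b' u + leibnizTwo iy iy c a' u) *
          v iy ^ 2 +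
      secondDiv a b c u * (a' u * v ix ^ 2 + 2 * b' u * (v ix * v iy) + c' u * v iy ^ 2) +
      secondDiv a' b' c' u * (a u * v ix ^ 2 + 2 * b u * (v ix * v iy) + c u * v iy ^ 2) +
      (poisson a b' u - poisson b a' u) * v ix ^ 2 +
      (poisson a c' u - poisson c a' u) * (v ix * v iy) +
      (poisson b c' u - poisson c b' u) * v iy ^ 2 := by
  have dmul : ∀ {f g : Coord 1 → ℝ}, ContDiffAt ℝ ∞ f u → ContDiffAt ℝ ∞ g u → ∀ i j,
      partialDeriv i (partialDeriv j fun z => f z * g z) u = leibnizTwo i j f g u :=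
    fun hf hg i j => fderiv_fderiv_mul hf hg _ _
  have comb := partialDeriv_partialDeriv_combination ha hb hc ha' hb' hc'
  simp only [dmul ha hc', dmul hb hb', dmul hc ha'] at comb
  simp only [planeGz, comb]

theorem partialDeriv_form {s : Coord 1 → SymForm 1} {u : Coord 1} (hs : ContDiffAt ℝ ∞ s u)
    (i : Fin 1 ⊕ Fin 1) (v w : Coord 1) :
    partialDeriv i (fun x => (s x).1 v w) u = (fderiv ℝ s u (basisVec i)).1 v w :=
  (fderiv_form_apply hs.differentiableAt_infty _ _ _).symm

theorem partialDeriv_partialDeriv_form {s : Coord 1 → SymForm 1} {u : Coord 1}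
    (hs : ContDiffAt ℝ ∞ s u) (i j : Fin 1 ⊕ Fin 1) (v w : Coord 1) :
    partialDeriv i (partialDeriv j fun x => (s x).1 v w) u =
      (fderiv ℝ (fderiv ℝ s) u (basisVec i) (basisVec j)).1 v w :=
  (fderiv_fderiv_form_apply hs _ _ _ _).symm

theorem fderiv_fderiv_form_symm {s : Coord 1 → SymForm 1} {u : Coord 1}
    (hs : ContDiffAt ℝ ∞ s u) (v w : Coord 1) :
    fderiv ℝ (fderiv ℝ s) u v w = fderiv ℝ (fderiv ℝ s) u w v :=
  hs.isSymmSndFDerivAt (by simpa using two_le_infty) _ _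

theorem poisson_plane (f g : Coord 1 → ℝ) (u : Coord 1) :
    poisson f g u =
      partialDeriv ix f u * partialDeriv iy g u - partialDeriv iy f u * partialDeriv ix g u := by
  simp [poisson, ix, iy]

theorem planeVec_eq (v : Coord 1) : planeVec (v ix) (v iy) = v := by
  ext k
  rcases k with k | k <;> fin_cases k <;> simp [ix, iy, basisVec, planeVec]

theorem gzExpr_apply_self {m : ℕ} (s t : Coord m → SymForm m) (u v : Coord m) :
    (gzExpr s t u).1 v v =
      (symbolTwo (m := m) (fderiv ℝ (fderiv ℝ s) u) (t u)).1 v v +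
      (symbolOne (m := m) (fderiv ℝ s u) (fderiv ℝ t u)).1 v v +
      (symbolTwo (m := m) (fderiv ℝ (fderiv ℝ t) u) (s u)).1 v v := rfl

set_option maxHeartbeats 4000000 in
/-- In dimension two the operator is the explicit one: both sides are polynomials in the components
of the 2-jets of `s` and `t`. -/
theorem gzExpr_plane {s t : Coord 1 → SymForm 1} {u : Coord 1} (hs : ContDiffAt ℝ ∞ s u)
    (ht : ContDiffAt ℝ ∞ t u) (v : Coord 1) :
    (gzExpr s t u).1 v v =
      planeGz (fun x => (s x).1 (basisVec ix) (basisVec ix))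
        (fun x => (s x).1 (basisVec ix) (basisVec iy))
        (fun x => (s x).1 (basisVec iy) (basisVec iy))
        (fun x => (t x).1 (basisVec ix) (basisVec ix))
        (fun x => (t x).1 (basisVec ix) (basisVec iy))
        (fun x => (t x).1 (basisVec iy) (basisVec iy))
        u v := by
  have e1 := symbolTwo_plane _ (t u) (fderiv_fderiv_form_symm hs _ _) (v ix) (v iy)
  have e2 := symbolTwo_plane _ (s u) (fderiv_fderiv_form_symm ht _ _) (v ix) (v iy)
  have e3 := symbolOne_plane (fderiv ℝ s u) (fderiv ℝ t u) (v ix) (v iy) _ _ _ _ rfl rfl rfl rfl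
  have cs := fun k l => hs.symForm_apply (basisVec k) (basisVec l)
  have ct := fun k l => ht.symForm_apply (basisVec k) (basisVec l)
  rw [planeVec_eq] at e1 e2 e3
  rw [gzExpr_apply_self, e1, e2, e3,
    planeGz_eq (cs _ _) (cs _ _) (cs _ _) (ct _ _) (ct _ _) (ct _ _)]
  have hv : ∀ b : SymForm 1,
      (∀ w, b.1 v w = v ix * b.1 (basisVec ix) w + v iy * b.1 (basisVec iy) w) ∧
      ∀ w, b.1 w v = v ix * b.1 w (basisVec ix) + v iy * b.1 w (basisVec iy) := fun b => by
    constructor <;> intro w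
    · rw [← SymForm.apply_planeVec_left, planeVec_eq]
    · rw [← SymForm.apply_planeVec_right, planeVec_eq]
  simp only [leibnizTwo, secondDiv, poisson_plane, partialDeriv_partialDeriv_form hs,
    partialDeriv_partialDeriv_form ht, partialDeriv_form hs, partialDeriv_form ht]
  simp only [(hv _).1, (hv _).2, SymForm.apply_iy_ix]
  ring

end PlaneFormula

end

theorem mainTheorem2 :
    ∃ Gz : (m : ℕ) → (M : Type u) → [TopologicalSpace M] → [ChartedSpace (Coord m) M] →
        [IsSymplecticManifold m M] →
        (SymTwoForms m M →ₗ[ℝ] SymTwoForms m M →ₗ[ℝ] SymTwoForms m M),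
      (∀ m : ℕ, 1 ≤ m →
        (∃ D : (Coord m → SymForm m) → (Coord m → SymForm m) → Coord m → SymForm m,
          IsBilinearDiffOp 2 D ∧ ¬ IsBilinearDiffOp 1 D ∧ IsExpressedBy (Gz m) D) ∧
        CommutesWithSymplectomorphisms (Gz m)) ∧
      ∀ (M : Type u) [TopologicalSpace M] [ChartedSpace (Coord 1) M] [IsSymplecticManifold 1 M]
        (h k : SymTwoForms 1 M) (e : DarbouxChart 1 M), ∀ u ∈ e.1.target, ∀ v : Coord 1,
          formValue (inChart (Gz 1 M h k) e u) v v =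
            planeGz (coeff h e ix ix) (coeff h e ix iy) (coeff h e iy iy)
              (coeff k e ix ix) (coeff k e ix iy) (coeff k e iy iy) u v := by
  refine ⟨fun m M _ _ _ => gzOperator m M, fun m hm => ⟨⟨gzExpr, isBilinearDiffOp_gzExpr,
    not_isBilinearDiffOp_one_gzExpr hm, ?_⟩, commutesWithSymplectomorphisms_gzOperator m⟩, ?_⟩
  · intro M _ _ _ s t e u hu
    exact inChart_gzOperator s t e hu
  · intro M _ _ _ h k e u hu v
    rw [inChart_gzOperator h k e hu]
    exact gzExpr_plane (inChart_contDiffAt h e hu) (inChart_contDiffAt k e hu) v
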